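/- Let $X$ be a proper $\mathrm{CAT}(-1)$ space with boundary at infinity $\partial X$ (asymptoty classes of geodesic rays, with the cone topology), and assume that the isometry group $\mathrm{Isom}(X)$ acts transitively on triples of distinct points of $\partial X$. For distinct $\xi_0,\eta_0,\xi_1,\eta_1\in\partial X$ let $$[\xi_0,\eta_0,\xi_1,\eta_1]_X=\lim e^{\frac12\left(d(x_0,x_1)+d(y_0,y_1)-d(x_0,y_1)-d(x_1,y_0)\right)}$$ be the cross ratio, the limit being taken as $x_0,y_0,x_1,y_1$ tend to $\xi_0,\eta_0,\xi_1,\eta_1$ along geodesic rays. Let $\varphi_k:\partial\mathbb H^2\to\partial X$, $k\in\mathbb N$, be continuous maps which are asymptotically Moebius: for all distinct $\xi_0,\eta_0,\xi_1,\eta_1\in\partial\mathbb H^2$, the points $\varphi_k(\xi_0),\varphi_k(\eta_0),\varphi_k(\xi_1),\varphi_k(\eta_1)$ are distinct for all large $k$ and $$\lim_{k\to\infty}[\varphi_k(\xi_0),\varphi_k(\eta_0),\varphi_k(\xi_1),\varphi_k(\eta_1)]_X=[\xi_0,\eta_0,\xi_1,\eta_1]_{\mathbb H^2}.$$ Then there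 exist isometries $g_k$ of $X$ and a map $\varphi_\infty:\partial\mathbb H^2\to\partial X$ such that $\lim_{k\to\infty}g_k\varphi_k(\xi)=\varphi_\infty(\xi)$ for every $\xi\in\partial\mathbb H^2$. Moreover $\varphi_\infty$ conjugates the geodesic flows: writing $T^1Y$ for the space of unit speed geodesic lines $c:\mathbb R\to Y$ with the uniform structure of uniform convergence on compact sets, and $(\phi_t c)(s)=c(s+t)$ for the geodesic flow, there is a map $\Psi:T^1\mathbb H^2\to T^1X$ which is a homeomorphism onto its image, uniformly continuous together with its inverse, such that $\Psi\circ\phi_t=\phi_t\circ\Psi$ for all $t\in\mathbb R$, and $\Psi(c)(\pm\infty)=\varphi_\infty(c(\pm\infty))$ for every $c\in T^1\mathbb H^2$. -/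

import Mathlib

open Filter Topology
open scoped NNReal UpperHalfPlane

noncomputable section

namespace CATBoundary

/-- `c` restricted to `[0, a]` is a geodesic segment of length `a`. -/
def IsGeodesicSegment {X : Type*} [MetricSpace X] (c : ℝ → X) (a : ℝ) : Prop :=
  0 ≤ a ∧ ∀ s ∈ Set.Icc 0 a, ∀ t ∈ Set.Icc 0 a, dist (c s) (c t) = |s - t|

/-- CAT(-1) spaces: geodesic metric spaces all of whose geodesic triangles are at least as thin as
their comparison triangles in the hyperbolic plane.
Two points of a triangle either lie on a common side (where the comparison inequality is an
equality) or on two sides which issue from a common vertex; `c₁` and `c₂` are two such sides, and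
`e₁`, `e₂` are the corresponding sides of a comparison triangle. -/
structure IsCATNegOne (X : Type*) [MetricSpace X] : Prop where
  exists_segment : ∀ x y : X, ∃ c : ℝ → X,
    IsGeodesicSegment c (dist x y) ∧ c 0 = x ∧ c (dist x y) = y
  comparison : ∀ (c₁ c₂ : ℝ → X) (e₁ e₂ : ℝ → ℍ) (a b : ℝ),
    IsGeodesicSegment c₁ a → IsGeodesicSegment c₂ b → c₁ 0 = c₂ 0 →
    IsGeodesicSegment e₁ a → IsGeodesicSegment e₂ b → e₁ 0 = e₂ 0 →
    dist (e₁ a) (e₂ b) = dist (c₁ a) (c₂ b) →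
    ∀ s ∈ Set.Icc 0 a, ∀ t ∈ Set.Icc 0 b, dist (c₁ s) (c₂ t) ≤ dist (e₁ s) (e₂ t)

/-- Geodesic rays `[0, ∞) → X`, with the topology of uniform convergence on compact sets. -/
abbrev GeodesicRay (X : Type*) [MetricSpace X] : Type _ := {c : C(ℝ≥0, X) // Isometry c}

/-- Two rays are asymptotic if they stay at bounded distance from each other. -/
def asymptoticSetoid (X : Type*) [MetricSpace X] : Setoid (GeodesicRay X) where
  r c d := ∃ C : ℝ, ∀ t : ℝ≥0, dist (c.1 t) (d.1 t) ≤ C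
  iseqv :=
    { refl := fun c => ⟨0, fun t => by simp⟩
      symm := fun ⟨C, h⟩ => ⟨C, fun t => by rw [dist_comm]; exact h t⟩
      trans := fun ⟨C, h⟩ ⟨D, k⟩ =>
        ⟨C + D, fun t => (dist_triangle _ _ _).trans (add_le_add (h t) (k t))⟩ }

/-- The boundary at infinity of `X`. -/
def Boundary (X : Type*) [MetricSpace X] : Type _ := Quotient (asymptoticSetoid X)

/-- The class `c(∞)` of a geodesic ray. -/
def GeodesicRay.endpoint {X : Type*} [MetricSpace X] (c : GeodesicRay X) : Boundary X :=
  Quotient.mk (asymptoticSetoid X) c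

/-- The cone topology on the boundary at infinity, with origin `x`: the quotient topology for
`c ↦ c(∞)`, from the rays issuing from `x` with the topology of uniform convergence on
compact sets. -/
abbrev coneTopology {X : Type*} [MetricSpace X] (x : X) : TopologicalSpace (Boundary X) :=
  TopologicalSpace.coinduced
    (fun c : {c : GeodesicRay X // c.1 0 = x} => GeodesicRay.endpoint c.1) inferInstance

/-- The image of a geodesic ray under an isometry. -/
def GeodesicRay.map {X : Type*} [MetricSpace X] (g : X ≃ᵢ X) (c : GeodesicRay X) :
    GeodesicRay X :=
  ⟨⟨fun t => g (c.1 t), g.continuous.comp c.1.continuous⟩, g.isometry.comp c.2⟩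

/-- The action of an isometry on the boundary at infinity. -/
def Boundary.map {X : Type*} [MetricSpace X] (g : X ≃ᵢ X) : Boundary X → Boundary X :=
  Quotient.map (GeodesicRay.map g) (fun _ _ ⟨C, h⟩ => ⟨C, fun t =>
    (g.isometry.dist_eq _ _).le.trans (h t)⟩)

/-- `Isom(X)` acts transitively on triples of distinct points of the boundary at infinity. -/
def TransitiveOnTriples (X : Type*) [MetricSpace X] : Prop :=
  ∀ ξ η ζ ξ' η' ζ' : Boundary X, ξ ≠ η → ξ ≠ ζ → η ≠ ζ → ξ' ≠ η' → ξ' ≠ ζ' → η' ≠ ζ' →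
    ∃ g : X ≃ᵢ X, Boundary.map g ξ = ξ' ∧ Boundary.map g η = η' ∧ Boundary.map g ζ = ζ'

/-- The four points are pairwise distinct. -/
def Distinct4 {A : Type*} (a b c d : A) : Prop :=
  a ≠ b ∧ a ≠ c ∧ a ≠ d ∧ b ≠ c ∧ b ≠ d ∧ c ≠ d

/-- `r` is the limit of `exp ((d(x₀,x₁) + d(y₀,y₁) - d(x₀,y₁) - d(x₁,y₀)) / 2)` as
`(x₀,y₀,x₁,y₁)` converges radially (along geodesic rays) to `(ξ₀,η₀,ξ₁,η₁)`. -/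
def IsCrossRatio {X : Type*} [MetricSpace X] (ξ₀ η₀ ξ₁ η₁ : Boundary X) (r : ℝ) : Prop :=
  ∀ c₀ d₀ c₁ d₁ : GeodesicRay X,
    c₀.endpoint = ξ₀ → d₀.endpoint = η₀ → c₁.endpoint = ξ₁ → d₁.endpoint = η₁ →
    Tendsto (fun t : ℝ≥0 × ℝ≥0 × ℝ≥0 × ℝ≥0 =>
        Real.exp ((dist (c₀.1 t.1) (c₁.1 t.2.2.1) + dist (d₀.1 t.2.1) (d₁.1 t.2.2.2)
          - dist (c₀.1 t.1) (d₁.1 t.2.2.2) - dist (c₁.1 t.2.2.1) (d₀.1 t.2.1)) / 2))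
      atTop (𝓝 r)

/-- The cross ratio of four points of the boundary at infinity (meaningful for pairwise distinct
points of the boundary of a proper CAT(-1) space, where the limit exists). -/
def crossRatio {X : Type*} [MetricSpace X] (ξ₀ η₀ ξ₁ η₁ : Boundary X) : ℝ :=
  Classical.epsilon (IsCrossRatio ξ₀ η₀ ξ₁ η₁)

/-- A sequence of boundary maps is asymptotically Moebius if the cross ratios of the images of any
four distinct points are defined for all large `k` and converge to the cross ratio of
these points. -/
def AsymptoticallyMoebius {X Y : Type*} [MetricSpace X] [MetricSpace Y]
    (φ : ℕ → Boundary X → Boundary Y) : Prop :=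
  ∀ ξ₀ η₀ ξ₁ η₁ : Boundary X, Distinct4 ξ₀ η₀ ξ₁ η₁ →
    (∀ᶠ k in atTop, Distinct4 (φ k ξ₀) (φ k η₀) (φ k ξ₁) (φ k η₁)) ∧
    Tendsto (fun k => crossRatio (φ k ξ₀) (φ k η₀) (φ k ξ₁) (φ k η₁)) atTop
      (𝓝 (crossRatio ξ₀ η₀ ξ₁ η₁))

/-- The unit tangent bundle of a CAT(-1) space: the space of unit speed geodesic lines `ℝ → X`,
with the uniform structure (and topology) of uniform convergence on compact sets. For the
hyperbolic plane a unit tangent vector corresponds to the geodesic line with that initial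
velocity. -/
abbrev GeodesicLine (X : Type*) [MetricSpace X] : Type _ := {c : C(ℝ, X) // Isometry c}

/-- The geodesic flow at time `t`: `c ↦ c(· + t)`. -/
def geodesicFlow {X : Type*} [MetricSpace X] (t : ℝ) (c : GeodesicLine X) : GeodesicLine X :=
  ⟨⟨fun s => c.1 (s + t), by fun_prop⟩,
    c.2.comp (Isometry.of_dist_eq fun a b => by simp)⟩

/-- The forward endpoint `c(+∞)`. -/
def GeodesicLine.posEnd {X : Type*} [MetricSpace X] (c : GeodesicLine X) : Boundary X :=
  GeodesicRay.endpoint ⟨⟨fun t : ℝ≥0 => c.1 (t : ℝ), by fun_prop⟩,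
    c.2.comp (Isometry.of_dist_eq fun _ _ => rfl)⟩

/-- The backward endpoint `c(-∞)`. -/
def GeodesicLine.negEnd {X : Type*} [MetricSpace X] (c : GeodesicLine X) : Boundary X :=
  GeodesicRay.endpoint ⟨⟨fun t : ℝ≥0 => c.1 (-(t : ℝ)), by fun_prop⟩,
    c.2.comp (Isometry.of_dist_eq fun a b => by rw [dist_neg_neg]; rfl)⟩

/-- A boundary map conjugates the geodesic flows: it is the map on endpoints of a map of unit tangent
bundles which commutes with the geodesic flows and is a homeomorphism onto its image, uniformly
continuous together with its inverse. (Without uniformity, every topological embedding of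
boundaries would qualify.) -/
def ConjugatesGeodesicFlows {X Y : Type*} [MetricSpace X] [MetricSpace Y]
    (φ : Boundary X → Boundary Y) : Prop :=
  ∃ Ψ : GeodesicLine X → GeodesicLine Y,
    IsUniformEmbedding Ψ ∧
    (∀ (t : ℝ) (c : GeodesicLine X), Ψ (geodesicFlow t c) = geodesicFlow t (Ψ c)) ∧
    ∀ c : GeodesicLine X,
      GeodesicLine.posEnd (Ψ c) = φ (GeodesicLine.posEnd c) ∧
      GeodesicLine.negEnd (Ψ c) = φ (GeodesicLine.negEnd c)

end CATBoundary

end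

/-!
A map of boundaries which respects visual metrics up to a conformal factor is the boundary map of
an isometric embedding of the hyperbolic plane. The theorem follows once the `g k ∘ φ k` are shown
to converge to such a map.

**Visual metrics.** The CAT(-1) inequality enters only through the Stewart inequality
`HasStewart`, which compares the distance from a point to a segment with the distances to its
endpoints. `HasStewart.ptolemy` deduces an approximate Ptolemy inequality for four points. Letting
the points go to infinity, the visual functions
`vis p ξ η = lim exp ((d(x, y) - d(p, x) - d(p, y)) / 2)`, where `x → ξ` and `y → η` along rays,
exist and satisfy the exact Ptolemy inequality (`HasStewart.vis_ptolemy`). Cross ratios are ratios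
of products of them (`HasStewart.crossRatio_eq`), and isometries and changes of base point act on
`vis` conformally (`HasStewart.vis_map_conformal`, `vis_conf`). In the upper half plane,
in the coordinate of `bdReal`, they are `|s - t|` up to a conformal factor (`vis_bdReal`),
and Ptolemy's inequality becomes an equality (`exists_ptolemy_eq`).

**Convergence.** By transitivity on triples, `g k` can be chosen to take the images of `∞, 0, 1`
to a fixed triple. As `X` is proper, every ultrafilter finer than `atTop` yields a pointwise limit
of `g k ∘ φ k`, and such a limit preserves cross ratios; so it is injective and conformal for
visual metrics (`isMoebius_of_rayTendsto`). It remains to see that all these limits coincide.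

**Uniqueness.** `IsMoebius.eq` shows that a Moebius embedding `f` is determined by its values on
`∞, 0, 1`. In the coordinate of `bdReal`, the functions `t ↦ vis x z (f t)` are, after conformal
normalisation, Lipschitz, hence differentiable almost everywhere, and `exists_regular_point`
provides a parameter where all of those with `z` in a countable dense set are differentiable.
Differentiating the Ptolemy inequality there shows that a point `m` of the image circle is
determined by two points `P`, `Q` of `∂X` and the ratio which `m` and the regular point cut out on
them by equality in the Ptolemy inequality. If two embeddings agreeing on the triple differed at
some `m`, an isometry of `X` would carry the regular point and two other points of the image
circle to a point of the triple and the two images of `m`, which are in the same position with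
respect to the other points of the triple; a contradiction.

**Extension to the interior.** Given `p` in the plane, a line through `p` with ends `ξ, η` is
matched with a point on the line of `X` with ends `f ξ, f η` for which the conformal factor is `1`
at `ξ` and at `η`. The visual Pythagoras inequality (`HasStewart.one_le_vis_sq`), an
equality in the plane, bounds the conformal factor below by `1` everywhere, and
`vis ≤ 1` applied to antipodal points bounds it above (`IsMoebius.exists_center`).
The resulting map `F` takes lines to lines with the
right ends (`exists_line_of_center`), so it is an isometric embedding, and `c ↦ F ∘ c` conjugates
the geodesic flows.
-/

namespace CATBoundary

/-! ### Stewart's inequality, and the Ptolemy inequality for four points -/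

/-- Geodesic metric spaces satisfying the inequality form of Stewart's theorem of hyperbolic
trigonometry, for a point and a geodesic segment. -/
structure HasStewart (X : Type*) [MetricSpace X] : Prop where
  exists_segment : ∀ x y : X, ∃ c : ℝ → X,
    IsGeodesicSegment c (dist x y) ∧ c 0 = x ∧ c (dist x y) = y
  stewart : ∀ (c : ℝ → X) (L : ℝ), IsGeodesicSegment c L → ∀ y : X, ∀ t ∈ Set.Icc 0 L,
    Real.cosh (dist y (c t)) * Real.sinh L ≤
      Real.cosh (dist y (c 0)) * Real.sinh (L - t) + Real.cosh (dist y (c L)) * Real.sinh t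

section Segments

variable {X : Type*} [MetricSpace X]

theorem IsGeodesicSegment.dist_zero {c : ℝ → X} {a t : ℝ} (hc : IsGeodesicSegment c a)
    (ht : t ∈ Set.Icc 0 a) : dist (c 0) (c t) = t := by
  rw [hc.2 0 ⟨le_rfl, hc.1⟩ t ht, zero_sub, abs_neg, abs_of_nonneg ht.1]

theorem IsGeodesicSegment.dist_end {c : ℝ → X} {a t : ℝ} (hc : IsGeodesicSegment c a)
    (ht : t ∈ Set.Icc 0 a) : dist (c a) (c t) = a - t := by
  rw [hc.2 a ⟨hc.1, le_rfl⟩ t ht, abs_of_nonneg (by linarith [ht.2])]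

theorem IsGeodesicSegment.reverse {c : ℝ → X} {a : ℝ} (hc : IsGeodesicSegment c a) :
    IsGeodesicSegment (fun t => c (a - t)) a := by
  refine ⟨hc.1, fun s hs t ht => ?_⟩
  rw [hc.2 _ ⟨by linarith [hs.2], by linarith [hs.1]⟩ _ ⟨by linarith [ht.2], by linarith [ht.1]⟩,
    show a - s - (a - t) = -(s - t) by ring, abs_neg]

theorem IsGeodesicSegment.sub {c : ℝ → X} {a b l : ℝ} (hc : IsGeodesicSegment c a) (hb : 0 ≤ b)
    (hl : 0 ≤ l) (h : b + l ≤ a) : IsGeodesicSegment (fun t => c (b + t)) l := by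
  refine ⟨hl, fun s hs t ht => ?_⟩
  rw [hc.2 _ ⟨by linarith [hs.1], by linarith [hs.2]⟩ _ ⟨by linarith [ht.1], by linarith [ht.2]⟩,
    add_sub_add_left_eq_sub]

theorem Isometry.isGeodesicSegment {c : ℝ → X} (hc : Isometry c) {a : ℝ} (ha : 0 ≤ a) (b : ℝ) :
    IsGeodesicSegment (fun t => c (b + t)) a :=
  ⟨ha, fun s _ t _ => by rw [hc.dist_eq, Real.dist_eq, add_sub_add_left_eq_sub]⟩

theorem GeodesicRay.dist_eq (c : GeodesicRay X) (s t : ℝ≥0) :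
    dist (c.1 s) (c.1 t) = |(s : ℝ) - t| := by
  rw [c.2.dist_eq, NNReal.dist_eq]

theorem GeodesicRay.dist_zero (c : GeodesicRay X) (t : ℝ≥0) : dist (c.1 0) (c.1 t) = t := by
  rw [c.dist_eq]; simp

theorem GeodesicRay.isGeodesicSegment (c : GeodesicRay X) {a : ℝ} (ha : 0 ≤ a) :
    IsGeodesicSegment (fun t => c.1 t.toNNReal) a :=
  ⟨ha, fun s hs t ht => by
    rw [c.dist_eq, Real.coe_toNNReal _ hs.1, Real.coe_toNNReal _ ht.1]⟩

end Segments

section FourPoints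

variable {X : Type*} [MetricSpace X]

theorem sinh_sub_le {L t : ℝ} (ht : 0 ≤ t) :
    Real.sinh (L - t) ≤ Real.exp (-t) * Real.sinh L := by
  rw [Real.sinh_eq, Real.sinh_eq, show -(L - t) = -L + t by ring, sub_eq_add_neg L t, Real.exp_add,
    Real.exp_add]
  have h1 : Real.exp (-t) ≤ Real.exp t := Real.exp_le_exp.2 (by linarith)
  nlinarith [Real.exp_pos (-L)]

theorem exp_le_two_mul_cosh (x : ℝ) : Real.exp x ≤ 2 * Real.cosh x := by
  rw [Real.cosh_eq]; linarith [Real.exp_pos (-x)]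

theorem two_mul_cosh_le {x : ℝ} (hx : 0 ≤ x) : 2 * Real.cosh x ≤ Real.exp x + 1 := by
  rw [Real.cosh_eq]; linarith [Real.exp_le_one_iff.2 (neg_nonpos.2 hx)]

theorem HasStewart.exp_dist_le (hX : HasStewart X) {c : ℝ → X} {L t : ℝ}
    (hc : IsGeodesicSegment c L) (ht : t ∈ Set.Icc 0 L) (y : X) :
    Real.exp (dist y (c t)) ≤ (Real.exp (dist y (c 0)) + 1) * Real.exp (-t) +
      (Real.exp (dist y (c L)) + 1) * Real.exp (-(L - t)) := by
  rcases hc.1.eq_or_lt with h0 | h0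
  · obtain rfl : t = 0 := le_antisymm (h0 ▸ ht.2) ht.1
    have := Real.exp_pos (dist y (c L))
    have := Real.exp_pos (-(L - 0))
    simp only [neg_zero, Real.exp_zero]
    nlinarith
  · have hs : 0 < Real.sinh L := Real.sinh_pos_iff.2 h0
    have h1 := hX.stewart c L hc y t ht
    have h2 := sinh_sub_le (L := L) ht.1
    have h3 := sinh_sub_le (L := L) (t := L - t) (by linarith [ht.2])
    rw [sub_sub_cancel] at h3
    refine le_of_mul_le_mul_right ?_ hs
    have c0 := two_mul_cosh_le (dist_nonneg (x := y) (y := c 0))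
    have cL := two_mul_cosh_le (dist_nonneg (x := y) (y := c L))
    have e0 := exp_le_two_mul_cosh (dist y (c t))
    have p0 := Real.cosh_pos (dist y (c 0))
    have pL := Real.cosh_pos (dist y (c L))
    have q0 : 0 ≤ Real.exp (-t) * Real.sinh L := by positivity
    have qL : 0 ≤ Real.exp (-(L - t)) * Real.sinh L := by positivity
    calc Real.exp (dist y (c t)) * Real.sinh L ≤ 2 * Real.cosh (dist y (c t)) * Real.sinh L := by
          gcongr
      _ ≤ 2 * Real.cosh (dist y (c 0)) * (Real.exp (-t) * Real.sinh L) +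
          2 * Real.cosh (dist y (c L)) * (Real.exp (-(L - t)) * Real.sinh L) := by nlinarith
      _ ≤ (Real.exp (dist y (c 0)) + 1) * (Real.exp (-t) * Real.sinh L) +
          (Real.exp (dist y (c L)) + 1) * (Real.exp (-(L - t)) * Real.sinh L) := by gcongr
      _ = _ := by ring

/-- The function `√(eᵃ + 1)`, a replacement of `e^{a/2}` for which the Ptolemy inequality holds for
all quadruples of points, not only asymptotically. -/
noncomputable def expHalf (a : ℝ) : ℝ := √(Real.exp a + 1)

theorem expHalf_pos (a : ℝ) : 0 < expHalf a := Real.sqrt_pos.2 (by positivity)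

theorem expHalf_sq (a : ℝ) : expHalf a ^ 2 = Real.exp a + 1 := Real.sq_sqrt (by positivity)

theorem expHalf_le {a b l : ℝ} (hl : 0 ≤ l) (h : a ≤ b + l) :
    expHalf a ≤ Real.exp (l / 2) * expHalf b := by
  refine le_of_sq_le_sq ?_ (by have := expHalf_pos b; positivity)
  rw [mul_pow, expHalf_sq, expHalf_sq, ← Real.exp_nat_mul]
  have h1 : Real.exp a ≤ Real.exp l * Real.exp b := by
    rw [← Real.exp_add]; exact Real.exp_le_exp.2 (by linarith)
  have h2 := Real.one_le_exp hl
  have : ((2 : ℕ) : ℝ) * (l / 2) = l := by push_cast; ring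
  rw [this]; linarith

/-- A Ptolemy inequality for four points. If `p` lies on the segment `[x, z]`, then
`d(y, w) ≤ d(y, p) + d(p, w)`; Stewart's inequality bounds both summands, and the position of `p` is
chosen such that the resulting bound is a perfect square. -/
theorem HasStewart.ptolemy (hX : HasStewart X) (x y z w : X) :
    Real.exp ((dist y w + dist x z) / 2) ≤
      expHalf (dist x y) * expHalf (dist z w) + expHalf (dist y z) * expHalf (dist x w) := by
  obtain ⟨c, hc, h0, hL⟩ := hX.exists_segment x z
  set L := dist x z with hLdef
  set a := expHalf (dist x y)
  set b := expHalf (dist y z)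
  set g := expHalf (dist x w)
  set h := expHalf (dist z w)
  have ha : 0 < a := expHalf_pos _
  have hb : 0 < b := expHalf_pos _
  have hg : 0 < g := expHalf_pos _
  have hh : 0 < h := expHalf_pos _
  have hL0 : 0 ≤ L := dist_nonneg
  have e1 : a ≤ Real.exp (L / 2) * b := expHalf_le hL0 (by
    have := dist_triangle x z y; rw [dist_comm z y] at this; linarith)
  have e2 : b ≤ Real.exp (L / 2) * a := expHalf_le hL0 (by
    have := dist_triangle y x z; rw [dist_comm y x] at this; linarith)
  have e3 : g ≤ Real.exp (L / 2) * h := expHalf_le hL0 (by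
    have := dist_triangle x z w; linarith)
  have e4 : h ≤ Real.exp (L / 2) * g := expHalf_le hL0 (by
    have := dist_triangle z x w; rw [dist_comm z x] at this; linarith)
  have hE : Real.exp (L / 2) * Real.exp (L / 2) = Real.exp L := by
    rw [← Real.exp_add]; congr 1; ring
  have e5 : a * g ≤ Real.exp L * (b * h) := by
    calc a * g ≤ (Real.exp (L / 2) * b) * (Real.exp (L / 2) * h) := by gcongr
      _ = _ := by rw [← hE]; ring
  have e6 : b * h ≤ Real.exp L * (a * g) := by
    calc b * h ≤ (Real.exp (L / 2) * a) * (Real.exp (L / 2) * g) := by gcongr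
      _ = _ := by rw [← hE]; ring
  set q := Real.log (a * g / (b * h)) with hq
  have hqexp : Real.exp q = a * g / (b * h) := Real.exp_log (by positivity)
  have q1 : q ≤ L := by
    rw [hq, Real.log_le_iff_le_exp (by positivity), div_le_iff₀ (by positivity)]; exact e5
  have q2 : -L ≤ q := by
    rw [hq, Real.le_log_iff_exp_le (by positivity), le_div_iff₀ (by positivity), Real.exp_neg,
      inv_mul_le_iff₀ (Real.exp_pos _)]
    exact e6
  -- the position of `p` for which the two squares in the product of the bounds are equal
  set t := (L + q) / 2 with ht
  have htm : t ∈ Set.Icc 0 L := ⟨by linarith, by linarith⟩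
  have hy := hX.exp_dist_le hc htm y
  have hw := hX.exp_dist_le hc htm w
  rw [h0, hL, dist_comm y x, ← expHalf_sq, ← expHalf_sq] at hy
  rw [h0, hL, dist_comm w x, dist_comm w z, ← expHalf_sq, ← expHalf_sq] at hw
  set U := Real.exp (-t)
  set V := Real.exp (-(L - t))
  have hUV : U * V = Real.exp (-L) := by
    rw [← Real.exp_add]; congr 1; ring
  have hbal : a * g * U = b * h * V := by
    have : V = Real.exp q * U := by
      rw [← Real.exp_add]
      refine congrArg Real.exp ?_
      rw [ht]; ring
    rw [this, hqexp]; field_simp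
  have hyw : Real.exp (dist y w) ≤ Real.exp (dist y (c t)) * Real.exp (dist w (c t)) := by
    rw [← Real.exp_add, dist_comm w]; exact Real.exp_le_exp.2 (dist_triangle _ _ _)
  have key : Real.exp (dist y w) ≤ Real.exp (-L) * (a * h + b * g) ^ 2 := by
    calc Real.exp (dist y w) ≤ (a ^ 2 * U + b ^ 2 * V) * (g ^ 2 * U + h ^ 2 * V) :=
          hyw.trans (by gcongr)
      _ = U * V * (a * h + b * g) ^ 2 := by linear_combination (a * g * U - b * h * V) * hbal
      _ = _ := by rw [hUV]
  refine le_of_sq_le_sq ?_ (by positivity)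
  rw [← Real.exp_nat_mul, show ((2 : ℕ) : ℝ) * ((dist y w + L) / 2) = dist y w + L by
    push_cast; ring, Real.exp_add]
  calc Real.exp (dist y w) * Real.exp L ≤ Real.exp (-L) * (a * h + b * g) ^ 2 * Real.exp L := by
        gcongr
    _ = (a * h + b * g) ^ 2 := by
        rw [mul_right_comm, ← Real.exp_add, neg_add_cancel, Real.exp_zero, one_mul]

/-- Two geodesic segments issuing from the same point diverge at least as fast as in the
hyperbolic plane. -/
theorem HasStewart.thin (hX : HasStewart X) {c d : ℝ → X} {T t : ℝ} (hc : IsGeodesicSegment c T)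
    (hd : IsGeodesicSegment d T) (h0 : c 0 = d 0) (ht : t ∈ Set.Icc 0 T) :
    Real.sinh T ^ 2 * (Real.cosh (dist (c t) (d t)) - 1) ≤
      Real.sinh t ^ 2 * (Real.cosh (dist (c T) (d T)) - 1) := by
  have h1 := hX.stewart d T hd (c T) t ht
  have h2 := hX.stewart c T hc (d t) t ht
  rw [← h0, dist_comm (c T) (c 0), hc.dist_zero ⟨hc.1, le_rfl⟩] at h1
  rw [h0, dist_comm (d t) (d 0), hd.dist_zero ht, dist_comm (d t) (c T), dist_comm (d t)] at h2
  have hT : 0 ≤ Real.sinh T := Real.sinh_nonneg_iff.2 hc.1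
  have hts : 0 ≤ Real.sinh t := Real.sinh_nonneg_iff.2 ht.1
  have e : Real.sinh (T - t) * (Real.cosh t * Real.sinh T + Real.sinh t * Real.cosh T) =
      Real.sinh T ^ 2 - Real.sinh t ^ 2 := by
    rw [Real.sinh_sub]
    linear_combination Real.sinh T ^ 2 * Real.cosh_sq t - Real.sinh t ^ 2 * Real.cosh_sq T
  have h3 := mul_le_mul_of_nonneg_right h2 hT
  have h4 := mul_le_mul_of_nonneg_right h1 hts
  nlinarith

theorem HasStewart.dist_le_of_le (hX : HasStewart X) {c d : ℝ → X} {T t : ℝ}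
    (hc : IsGeodesicSegment c T) (hd : IsGeodesicSegment d T) (h0 : c 0 = d 0)
    (ht : t ∈ Set.Icc 0 T) : dist (c t) (d t) ≤ dist (c T) (d T) := by
  rcases hc.1.eq_or_lt with hT | hT
  · obtain rfl : t = T := le_antisymm ht.2 (hT ▸ ht.1)
    rfl
  have h := hX.thin hc hd h0 ht
  have hs : 0 < Real.sinh T := Real.sinh_pos_iff.2 hT
  have hts : 0 ≤ Real.sinh t := Real.sinh_nonneg_iff.2 ht.1
  have hle : Real.sinh t ^ 2 ≤ Real.sinh T ^ 2 :=
    pow_le_pow_left₀ hts (Real.sinh_le_sinh.2 ht.2) 2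
  have h1 := Real.one_le_cosh (dist (c T) (d T))
  have h2 : Real.cosh (dist (c t) (d t)) ≤ Real.cosh (dist (c T) (d T)) := by
    have : Real.sinh T ^ 2 * (Real.cosh (dist (c t) (d t)) - 1) ≤
        Real.sinh T ^ 2 * (Real.cosh (dist (c T) (d T)) - 1) := h.trans (by gcongr)
    linarith [le_of_mul_le_mul_left this (by positivity)]
  rw [Real.cosh_le_cosh, abs_of_nonneg dist_nonneg, abs_of_nonneg dist_nonneg] at h2
  exact h2

/-- Two geodesic segments with the same endpoint stay close to each other if their origins are
close. -/
theorem HasStewart.fellow_travel (hX : HasStewart X) {c d : ℝ → X} {a b t : ℝ}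
    (hc : IsGeodesicSegment c a) (hd : IsGeodesicSegment d b) (h : c a = d b)
    (hta : t ∈ Set.Icc 0 a) (htb : t ∈ Set.Icc 0 b) :
    dist (c t) (d t) ≤ 3 * dist (c 0) (d 0) := by
  wlog hab : a ≤ b generalizing c d a b
  · rw [dist_comm (c t), dist_comm (c 0)]
    exact this hd hc h.symm htb hta (le_of_not_ge hab)
  have hba : b - a ≤ dist (c 0) (d 0) := by
    have h1 := hd.dist_zero ⟨hd.1, le_rfl⟩
    have h2 := hc.dist_zero ⟨hc.1, le_rfl⟩
    have h3 := dist_triangle (d 0) (c 0) (d b)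
    rw [h1, ← h, h2, dist_comm (d 0)] at h3
    linarith
  have hc' := hc.reverse
  have hd' : IsGeodesicSegment (fun s => d (b - s)) a := by
    simpa using hd.reverse.sub le_rfl hc.1 (by linarith)
  have h1 := hX.dist_le_of_le hc' hd' (by simpa using h) (t := a - t)
    ⟨by linarith [hta.2], by linarith [hta.1]⟩
  simp only [sub_sub_cancel, sub_self] at h1
  have h2 : dist (d (b - (a - t))) (d t) = b - a := by
    rw [hd.2 _ ⟨by linarith [hta.1], by linarith [hta.2]⟩ _ htb,
      show b - (a - t) - t = b - a by ring, abs_of_nonneg (by linarith)]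
  have h3 : dist (d 0) (d (b - a)) = b - a := hd.dist_zero ⟨by linarith, by linarith [hc.1]⟩
  have h4 := dist_triangle (c t) (d (b - (a - t))) (d t)
  have h5 := dist_triangle (c 0) (d 0) (d (b - a))
  linarith

end FourPoints

/-! ### Horospherical products of rays and the visual metrics -/

section Rays

variable {X : Type*} [MetricSpace X]

/-- The horospherical product `lim exp ((d(c(s), d(t)) - s - t) / 2)` of two geodesic rays. The
expression is antitone in `s` and `t`, whence the infimum. -/
noncomputable def GeodesicRay.horo (c d : GeodesicRay X) : ℝ :=
  ⨅ p : ℝ≥0 × ℝ≥0, Real.exp ((dist (c.1 p.1) (d.1 p.2) - p.1 - p.2) / 2)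

/-- The exponential `exp (b(p) / 2)` of half the Busemann function `b` of a geodesic ray,
`b(p) = lim (d(p, c(t)) - t)`. -/
noncomputable def GeodesicRay.busemannExp (c : GeodesicRay X) (p : X) : ℝ :=
  ⨅ t : ℝ≥0, Real.exp ((dist p (c.1 t) - t) / 2)

theorem GeodesicRay.horo_antitone (c d : GeodesicRay X) : Antitone fun p : ℝ≥0 × ℝ≥0 =>
    Real.exp ((dist (c.1 p.1) (d.1 p.2) - p.1 - p.2) / 2) := by
  rintro ⟨s, t⟩ ⟨s', t'⟩ ⟨hs, ht⟩
  simp only at hs ht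
  have hs' : (s : ℝ) ≤ s' := hs
  have ht' : (t : ℝ) ≤ t' := ht
  have h1 := dist_triangle4 (c.1 s') (c.1 s) (d.1 t) (d.1 t')
  rw [c.dist_eq, d.dist_eq, abs_of_nonneg (by linarith), abs_sub_comm,
    abs_of_nonneg (by linarith)] at h1
  exact Real.exp_le_exp.2 (by dsimp only; linarith)

theorem GeodesicRay.busemannExp_antitone (c : GeodesicRay X) (p : X) : Antitone fun t : ℝ≥0 =>
    Real.exp ((dist p (c.1 t) - t) / 2) := by
  intro t t' ht
  have ht' : (t : ℝ) ≤ t' := ht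
  have h1 := dist_triangle p (c.1 t) (c.1 t')
  rw [c.dist_eq, abs_sub_comm, abs_of_nonneg (by linarith)] at h1
  exact Real.exp_le_exp.2 (by linarith)

theorem GeodesicRay.tendsto_horo (c d : GeodesicRay X) : Tendsto (fun p : ℝ≥0 × ℝ≥0 =>
    Real.exp ((dist (c.1 p.1) (d.1 p.2) - p.1 - p.2) / 2)) atTop (𝓝 (c.horo d)) :=
  tendsto_atTop_ciInf (c.horo_antitone d) ⟨0, by rintro _ ⟨p, rfl⟩; positivity⟩

theorem GeodesicRay.horo_le (c d : GeodesicRay X) (s t : ℝ≥0) :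
    c.horo d ≤ Real.exp ((dist (c.1 s) (d.1 t) - s - t) / 2) :=
  ciInf_le (f := fun p : ℝ≥0 × ℝ≥0 => Real.exp ((dist (c.1 p.1) (d.1 p.2) - p.1 - p.2) / 2))
    ⟨0, by rintro _ ⟨p, rfl⟩; positivity⟩ (s, t)

theorem GeodesicRay.tendsto_busemannExp (c : GeodesicRay X) (p : X) : Tendsto (fun t : ℝ≥0 =>
    Real.exp ((dist p (c.1 t) - t) / 2)) atTop (𝓝 (c.busemannExp p)) :=
  tendsto_atTop_ciInf (c.busemannExp_antitone p) ⟨0, by rintro _ ⟨p, rfl⟩; positivity⟩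

theorem GeodesicRay.tendsto_horo_diag (c d : GeodesicRay X) : Tendsto (fun t : ℝ≥0 =>
    Real.exp (dist (c.1 t) (d.1 t) / 2 - t)) atTop (𝓝 (c.horo d)) := by
  refine ((c.tendsto_horo d).comp tendsto_atTop_diagonal).congr fun t => ?_
  simp only [Function.comp_apply]
  congr 1; ring

theorem GeodesicRay.horo_nonneg (c d : GeodesicRay X) : 0 ≤ c.horo d :=
  ge_of_tendsto' (c.tendsto_horo d) fun _ => (Real.exp_pos _).le

theorem GeodesicRay.busemannExp_pos (c : GeodesicRay X) (p : X) : 0 < c.busemannExp p := by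
  refine (Real.exp_pos (-dist p (c.1 0) / 2)).trans_le (le_ciInf fun t => ?_)
  have h := dist_triangle (c.1 0) p (c.1 t)
  rw [c.dist_zero, dist_comm _ p] at h
  exact Real.exp_le_exp.2 (by linarith)

theorem GeodesicRay.busemannExp_zero (c : GeodesicRay X) : c.busemannExp (c.1 0) = 1 := by
  refine tendsto_nhds_unique (c.tendsto_busemannExp _) ?_
  simp [c.dist_zero]

theorem GeodesicRay.horo_comm (c d : GeodesicRay X) : c.horo d = d.horo c := by
  refine tendsto_nhds_unique (c.tendsto_horo_diag d) ((d.tendsto_horo_diag c).congr fun t => ?_)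
  rw [dist_comm]

theorem tendsto_exp_neg_coe : Tendsto (fun t : ℝ≥0 => Real.exp (-(t : ℝ))) atTop (𝓝 0) :=
  Real.tendsto_exp_neg_atTop_nhds_zero.comp (NNReal.tendsto_coe_atTop.2 tendsto_id)

theorem endpoint_eq_iff {c d : GeodesicRay X} :
    c.endpoint = d.endpoint ↔ ∃ C : ℝ, ∀ t : ℝ≥0, dist (c.1 t) (d.1 t) ≤ C :=
  Quotient.eq (r := asymptoticSetoid X)

theorem exists_endpoint_eq (ξ : Boundary X) : ∃ c : GeodesicRay X, c.endpoint = ξ :=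
  Quotient.exists_rep ξ

theorem GeodesicRay.horo_eq_zero {c d : GeodesicRay X} (h : c.endpoint = d.endpoint) :
    c.horo d = 0 := by
  obtain ⟨C, hC⟩ := endpoint_eq_iff.1 h
  refine tendsto_nhds_unique (c.tendsto_horo_diag d) ?_
  have h0 : Tendsto (fun t : ℝ≥0 => Real.exp (C / 2) * Real.exp (-(t : ℝ))) atTop (𝓝 0) := by
    simpa using tendsto_exp_neg_coe.const_mul (Real.exp (C / 2))
  refine squeeze_zero (fun t => (Real.exp_pos _).le) (fun t => ?_) h0
  rw [← Real.exp_add]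
  exact Real.exp_le_exp.2 (by linarith [hC t])

/-! The limits of the terms of the Ptolemy and Stewart inequalities. -/

theorem GeodesicRay.tendsto_expHalf (c d : GeodesicRay X) : Tendsto (fun t : ℝ≥0 =>
    expHalf (dist (c.1 t) (d.1 t)) * Real.exp (-(t : ℝ))) atTop (𝓝 (c.horo d)) := by
  have h := (((c.tendsto_horo_diag d).pow 2).add (tendsto_exp_neg_coe.pow 2)).sqrt
  rw [zero_pow two_ne_zero, add_zero, Real.sqrt_sq (c.horo_nonneg d)] at h
  refine h.congr fun t => ?_
  rw [expHalf, ← Real.sqrt_sq (Real.exp_pos (-(t : ℝ))).le, ← Real.sqrt_mul (by positivity),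
    Real.sqrt_sq (Real.exp_pos (-(t : ℝ))).le]
  congr 1
  rw [add_mul, one_mul, ← Real.exp_nat_mul, ← Real.exp_nat_mul, ← Real.exp_add]
  congr 2
  push_cast; ring

theorem GeodesicRay.tendsto_expHalf_point (c : GeodesicRay X) (p : X) : Tendsto (fun t : ℝ≥0 =>
    expHalf (dist p (c.1 t)) * Real.exp (-(t : ℝ) / 2)) atTop (𝓝 (c.busemannExp p)) := by
  have h := (((c.tendsto_busemannExp p).pow 2).add tendsto_exp_neg_coe).sqrt
  rw [add_zero, Real.sqrt_sq (c.busemannExp_pos p).le] at h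
  refine h.congr fun t => ?_
  rw [expHalf, ← Real.sqrt_sq (Real.exp_pos (-(t : ℝ) / 2)).le, ← Real.sqrt_mul (by positivity)]
  congr 1
  rw [add_mul, one_mul, ← Real.exp_nat_mul, ← Real.exp_nat_mul, ← Real.exp_add]
  congr 2 <;> push_cast <;> ring

theorem GeodesicRay.tendsto_cosh (c d : GeodesicRay X) : Tendsto (fun t : ℝ≥0 =>
    2 * Real.cosh (dist (c.1 t) (d.1 t)) * Real.exp (-(2 * t : ℝ))) atTop
    (𝓝 (c.horo d ^ 2)) := by
  have h1 : Tendsto (fun t : ℝ≥0 => Real.exp (-(2 * t + dist (c.1 t) (d.1 t) : ℝ))) atTop (𝓝 0) :=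
    squeeze_zero (fun t => (Real.exp_pos _).le) (fun t => Real.exp_le_exp.2 (by
      have : (0 : ℝ) ≤ t := t.2
      linarith [dist_nonneg (x := c.1 t) (y := d.1 t)])) tendsto_exp_neg_coe
  have h := ((c.tendsto_horo_diag d).pow 2).add h1
  rw [add_zero] at h
  refine h.congr fun t => ?_
  rw [Real.cosh_eq, ← Real.exp_nat_mul, mul_div_cancel₀ _ two_ne_zero, add_mul, ← Real.exp_add,
    ← Real.exp_add]
  congr 2 <;> push_cast <;> ring

theorem GeodesicRay.tendsto_cosh_point (c : GeodesicRay X) (p : X) : Tendsto (fun t : ℝ≥0 =>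
    2 * Real.cosh (dist p (c.1 t)) * Real.exp (-(t : ℝ))) atTop (𝓝 (c.busemannExp p ^ 2)) := by
  have h1 : Tendsto (fun t : ℝ≥0 => Real.exp (-(t + dist p (c.1 t) : ℝ))) atTop (𝓝 0) :=
    squeeze_zero (fun t => (Real.exp_pos _).le) (fun t => Real.exp_le_exp.2 (by
      linarith [dist_nonneg (x := p) (y := c.1 t)])) tendsto_exp_neg_coe
  have h := ((c.tendsto_busemannExp p).pow 2).add h1
  rw [add_zero] at h
  refine h.congr fun t => ?_
  rw [Real.cosh_eq, ← Real.exp_nat_mul, mul_div_cancel₀ _ two_ne_zero, add_mul, ← Real.exp_add,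
    ← Real.exp_add]
  congr 2 <;> push_cast <;> ring

/-- The Ptolemy inequality at infinity. -/
theorem HasStewart.horo_ptolemy (hX : HasStewart X) (a b c d : GeodesicRay X) :
    a.horo c * b.horo d ≤ a.horo b * c.horo d + b.horo c * a.horo d := by
  refine le_of_tendsto_of_tendsto'
    ((a.tendsto_horo_diag c).mul (b.tendsto_horo_diag d))
    (((a.tendsto_expHalf b).mul (c.tendsto_expHalf d)).add
      ((b.tendsto_expHalf c).mul (a.tendsto_expHalf d))) fun t => ?_
  have h := mul_le_mul_of_nonneg_right (hX.ptolemy (a.1 t) (b.1 t) (c.1 t) (d.1 t))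
    (mul_pos (Real.exp_pos (-(t : ℝ))) (Real.exp_pos (-(t : ℝ)))).le
  rw [← Real.exp_add, ← Real.exp_add] at h
  rw [← Real.exp_add]
  refine le_trans (le_of_eq ?_) (h.trans (le_of_eq ?_))
  · congr 1; ring
  · rw [Real.exp_add]; ring

/-- The Ptolemy inequality for three points at infinity and a point of the space. -/
theorem HasStewart.horo_triangle (hX : HasStewart X) (a b c : GeodesicRay X) (p : X) :
    a.horo c * b.busemannExp p ≤ a.horo b * c.busemannExp p + b.horo c * a.busemannExp p := by
  refine le_of_tendsto_of_tendsto'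
    ((a.tendsto_horo_diag c).mul (b.tendsto_busemannExp p))
    (((a.tendsto_expHalf b).mul (c.tendsto_expHalf_point p)).add
      ((b.tendsto_expHalf c).mul (a.tendsto_expHalf_point p))) fun t => ?_
  have h := mul_le_mul_of_nonneg_right (hX.ptolemy (a.1 t) (b.1 t) (c.1 t) p)
    (mul_pos (Real.exp_pos (-(t : ℝ))) (Real.exp_pos (-(t : ℝ) / 2))).le
  rw [← Real.exp_add, ← Real.exp_add, dist_comm (b.1 t) p, dist_comm (c.1 t) p,
    dist_comm (a.1 t) p] at h
  rw [← Real.exp_add]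
  refine le_trans (le_of_eq ?_) (h.trans (le_of_eq ?_))
  · congr 1; ring
  · rw [Real.exp_add]; ring

/-- As `p` varies, the horospherical product of two rays is at most `exp ((b + b') / 2)`, where `b`
and `b'` are their Busemann functions. -/
theorem GeodesicRay.horo_le_mul (c d : GeodesicRay X) (p : X) :
    c.horo d ≤ c.busemannExp p * d.busemannExp p := by
  refine le_of_tendsto_of_tendsto' (c.tendsto_horo_diag d)
    ((c.tendsto_busemannExp p).mul (d.tendsto_busemannExp p)) fun t => ?_
  rw [← Real.exp_add]
  refine Real.exp_le_exp.2 ?_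
  have := dist_triangle (c.1 t) p (d.1 t)
  rw [dist_comm (c.1 t) p] at this
  linarith

/-- Busemann functions of asymptotic rays differ by a constant, which is compatible with the
horospherical products. This is the equality case of `HasStewart.horo_triangle`, the horospherical
product of the two rays being zero. -/
theorem HasStewart.horo_congr (hX : HasStewart X) {c c' : GeodesicRay X}
    (h : c.endpoint = c'.endpoint) (d : GeodesicRay X) (p : X) :
    c.horo d * c'.busemannExp p = c'.horo d * c.busemannExp p := by
  have h0 := GeodesicRay.horo_eq_zero h
  have h1 := hX.horo_triangle c c' d p
  have h2 := hX.horo_triangle c' c d p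
  rw [GeodesicRay.horo_comm c' c] at h2
  rw [h0, zero_mul, zero_add] at h1 h2
  exact le_antisymm h1 h2

/-- The visual metric `exp (-(ξ | η)_p)` on the boundary at infinity, seen from `p`. It is computed
with chosen rays; `HasStewart.vis_endpoint` shows that any other rays give the same value. -/
noncomputable def vis (p : X) (ξ η : Boundary X) : ℝ :=
  let c : GeodesicRay X := Quotient.out ξ
  let d : GeodesicRay X := Quotient.out η
  c.horo d / (c.busemannExp p * d.busemannExp p)

theorem out_endpoint (ξ : Boundary X) :
    GeodesicRay.endpoint (Quotient.out ξ : GeodesicRay X) = ξ := Quotient.out_eq ξ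

theorem HasStewart.vis_endpoint (hX : HasStewart X) (p : X) (c d : GeodesicRay X) :
    vis p c.endpoint d.endpoint = c.horo d / (c.busemannExp p * d.busemannExp p) := by
  rw [vis]
  set c' : GeodesicRay X := Quotient.out c.endpoint
  set d' : GeodesicRay X := Quotient.out d.endpoint
  have h1 := hX.horo_congr (out_endpoint c.endpoint) d' p
  have h2 := hX.horo_congr (out_endpoint d.endpoint) c p
  change c'.horo d' * _ = _ * c'.busemannExp p at h1
  change d'.horo c * _ = _ * d'.busemannExp p at h2
  rw [d'.horo_comm, d.horo_comm] at h2
  have := c.busemannExp_pos p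
  have := d.busemannExp_pos p
  have := c'.busemannExp_pos p
  have := d'.busemannExp_pos p
  rw [div_eq_div_iff (by positivity) (by positivity)]
  linear_combination d.busemannExp p * h1 + c'.busemannExp p * h2

theorem vis_comm (p : X) (ξ η : Boundary X) : vis p ξ η = vis p η ξ := by
  simp only [vis]
  rw [GeodesicRay.horo_comm, mul_comm]

theorem vis_nonneg (p : X) (ξ η : Boundary X) : 0 ≤ vis p ξ η :=
  div_nonneg (GeodesicRay.horo_nonneg _ _)
    (mul_pos (GeodesicRay.busemannExp_pos _ _) (GeodesicRay.busemannExp_pos _ _)).le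

theorem vis_le_one (p : X) (ξ η : Boundary X) : vis p ξ η ≤ 1 :=
  div_le_one_of_le₀ (GeodesicRay.horo_le_mul _ _ p)
    (mul_pos (GeodesicRay.busemannExp_pos _ _) (GeodesicRay.busemannExp_pos _ _)).le

theorem vis_self (p : X) (ξ : Boundary X) : vis p ξ ξ = 0 := by
  simp only [vis]
  rw [GeodesicRay.horo_eq_zero rfl, zero_div]

theorem HasStewart.vis_ptolemy (hX : HasStewart X) (p : X) (a b c d : Boundary X) :
    vis p a c * vis p b d ≤ vis p a b * vis p c d + vis p b c * vis p a d := by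
  obtain ⟨a, rfl⟩ := exists_endpoint_eq a
  obtain ⟨b, rfl⟩ := exists_endpoint_eq b
  obtain ⟨c, rfl⟩ := exists_endpoint_eq c
  obtain ⟨d, rfl⟩ := exists_endpoint_eq d
  have ha := a.busemannExp_pos p
  have hb := b.busemannExp_pos p
  have hc := c.busemannExp_pos p
  have hd := d.busemannExp_pos p
  simp only [hX.vis_endpoint, div_mul_div_comm]
  rw [show a.busemannExp p * b.busemannExp p * (c.busemannExp p * d.busemannExp p) =
      a.busemannExp p * c.busemannExp p * (b.busemannExp p * d.busemannExp p) by ring,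
    show b.busemannExp p * c.busemannExp p * (a.busemannExp p * d.busemannExp p) =
      a.busemannExp p * c.busemannExp p * (b.busemannExp p * d.busemannExp p) by ring,
    ← add_div]
  gcongr
  exact hX.horo_ptolemy a b c d

/-- Visual metrics seen from different points are conformally equivalent. -/
theorem vis_basepoint (p q : X) : ∃ j : Boundary X → ℝ, (∀ ξ, 0 < j ξ) ∧
    ∀ ξ η, vis q ξ η = j ξ * j η * vis p ξ η := by
  refine ⟨fun ξ => GeodesicRay.busemannExp (Quotient.out ξ) p /
    GeodesicRay.busemannExp (Quotient.out ξ) q, fun ξ => div_pos (GeodesicRay.busemannExp_pos _ _)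
    (GeodesicRay.busemannExp_pos _ _), fun ξ η => ?_⟩
  simp only [vis]
  set c : GeodesicRay X := Quotient.out ξ
  set d : GeodesicRay X := Quotient.out η
  have := c.busemannExp_pos p
  have := d.busemannExp_pos p
  have := c.busemannExp_pos q
  have := d.busemannExp_pos q
  field_simp

theorem GeodesicRay.endpoint_map (g : X ≃ᵢ X) (c : GeodesicRay X) :
    Boundary.map g c.endpoint = (c.map g).endpoint := rfl

theorem HasStewart.vis_map (hX : HasStewart X) (g : X ≃ᵢ X) (p : X) (ξ η : Boundary X) :
    vis (g p) (Boundary.map g ξ) (Boundary.map g η) = vis p ξ η := by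
  obtain ⟨c, rfl⟩ := exists_endpoint_eq ξ
  obtain ⟨d, rfl⟩ := exists_endpoint_eq η
  have h1 : ∀ a b : GeodesicRay X, (a.map g).horo (b.map g) = a.horo b := fun a b => by
    simp only [GeodesicRay.horo, GeodesicRay.map, ContinuousMap.coe_mk, g.isometry.dist_eq]
  have h2 : ∀ a : GeodesicRay X, (a.map g).busemannExp (g p) = a.busemannExp p := fun a => by
    simp only [GeodesicRay.busemannExp, GeodesicRay.map, ContinuousMap.coe_mk, g.isometry.dist_eq]
  rw [GeodesicRay.endpoint_map, GeodesicRay.endpoint_map, hX.vis_endpoint, hX.vis_endpoint, h1, h2,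
    h2]

/-- Isometries act on the boundary at infinity by conformal maps. -/
theorem HasStewart.vis_map_conformal (hX : HasStewart X) (g : X ≃ᵢ X) (p : X) :
    ∃ j : Boundary X → ℝ, (∀ ξ, 0 < j ξ) ∧
      ∀ ξ η, vis p (Boundary.map g ξ) (Boundary.map g η) = j ξ * j η * vis p ξ η := by
  obtain ⟨j, hj, h⟩ := vis_basepoint (g p) p
  exact ⟨fun ξ => j (Boundary.map g ξ), fun ξ => hj _, fun ξ η => by rw [h, hX.vis_map]⟩

/-- The cross ratio of four pairwise distinct points in terms of a visual metric. -/
theorem HasStewart.isCrossRatio (hX : HasStewart X) (p : X) {ξ₀ η₀ ξ₁ η₁ : Boundary X}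
    (h1 : vis p ξ₀ η₁ ≠ 0) (h2 : vis p ξ₁ η₀ ≠ 0) : IsCrossRatio ξ₀ η₀ ξ₁ η₁
      (vis p ξ₀ ξ₁ * vis p η₀ η₁ / (vis p ξ₀ η₁ * vis p ξ₁ η₀)) := by
  rintro c₀ d₀ c₁ d₁ rfl rfl rfl rfl
  simp only [hX.vis_endpoint] at h1 h2 ⊢
  have p1 := c₀.busemannExp_pos p
  have p2 := d₀.busemannExp_pos p
  have p3 := c₁.busemannExp_pos p
  have p4 := d₁.busemannExp_pos p
  have h1' : c₀.horo d₁ ≠ 0 := fun h => h1 (by rw [h, zero_div])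
  have h2' : c₁.horo d₀ ≠ 0 := fun h => h2 (by rw [h, zero_div])
  have e : c₀.horo c₁ / (c₀.busemannExp p * c₁.busemannExp p) *
      (d₀.horo d₁ / (d₀.busemannExp p * d₁.busemannExp p)) /
      (c₀.horo d₁ / (c₀.busemannExp p * d₁.busemannExp p) *
        (c₁.horo d₀ / (c₁.busemannExp p * d₀.busemannExp p))) =
      c₀.horo c₁ * d₀.horo d₁ / (c₀.horo d₁ * c₁.horo d₀) := by
    field_simp
  rw [e]
  have t1 : Tendsto (fun t : ℝ≥0 × ℝ≥0 × ℝ≥0 × ℝ≥0 => t.1) atTop atTop := by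
    rw [← prod_atTop_atTop_eq]; exact tendsto_fst
  have t' : Tendsto (fun t : ℝ≥0 × ℝ≥0 × ℝ≥0 × ℝ≥0 => t.2) atTop atTop := by
    rw [← prod_atTop_atTop_eq]; exact tendsto_snd
  have t2 : Tendsto (fun t : ℝ≥0 × ℝ≥0 × ℝ≥0 × ℝ≥0 => t.2.1) atTop atTop := by
    refine Tendsto.comp (g := Prod.fst) ?_ t'
    rw [← prod_atTop_atTop_eq]; exact tendsto_fst
  have t'' : Tendsto (fun t : ℝ≥0 × ℝ≥0 × ℝ≥0 × ℝ≥0 => t.2.2) atTop atTop := by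
    refine Tendsto.comp (g := Prod.snd) ?_ t'
    rw [← prod_atTop_atTop_eq]; exact tendsto_snd
  have t3 : Tendsto (fun t : ℝ≥0 × ℝ≥0 × ℝ≥0 × ℝ≥0 => t.2.2.1) atTop atTop := by
    refine Tendsto.comp (g := Prod.fst) ?_ t''
    rw [← prod_atTop_atTop_eq]; exact tendsto_fst
  have t4 : Tendsto (fun t : ℝ≥0 × ℝ≥0 × ℝ≥0 × ℝ≥0 => t.2.2.2) atTop atTop := by
    refine Tendsto.comp (g := Prod.snd) ?_ t''
    rw [← prod_atTop_atTop_eq]; exact tendsto_snd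
  have l : ∀ {u v : ℝ≥0 × ℝ≥0 × ℝ≥0 × ℝ≥0 → ℝ≥0}, Tendsto u atTop atTop → Tendsto v atTop atTop →
      Tendsto (fun t => (u t, v t)) atTop atTop := fun hu hv => by
    rw [← prod_atTop_atTop_eq (α := ℝ≥0) (β := ℝ≥0)]; exact hu.prodMk hv
  have l1 := (c₀.tendsto_horo c₁).comp (l t1 t3)
  have l2 := (d₀.tendsto_horo d₁).comp (l t2 t4)
  have l3 := (c₀.tendsto_horo d₁).comp (l t1 t4)
  have l4 := (c₁.tendsto_horo d₀).comp (l t3 t2)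
  refine ((l1.mul l2).div (l3.mul l4) (mul_ne_zero h1' h2')).congr fun t => ?_
  simp only [Function.comp_apply, Pi.div_apply]
  rw [← Real.exp_add, ← Real.exp_add, ← Real.exp_sub]
  congr 1; ring

theorem IsCrossRatio.unique {ξ₀ η₀ ξ₁ η₁ : Boundary X} {r s : ℝ} (hr : IsCrossRatio ξ₀ η₀ ξ₁ η₁ r)
    (hs : IsCrossRatio ξ₀ η₀ ξ₁ η₁ s) : r = s :=
  tendsto_nhds_unique
    (hr _ _ _ _ (out_endpoint ξ₀) (out_endpoint η₀) (out_endpoint ξ₁) (out_endpoint η₁))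
    (hs _ _ _ _ (out_endpoint ξ₀) (out_endpoint η₀) (out_endpoint ξ₁) (out_endpoint η₁))

theorem HasStewart.crossRatio_eq (hX : HasStewart X) (p : X) {ξ₀ η₀ ξ₁ η₁ : Boundary X}
    (h1 : vis p ξ₀ η₁ ≠ 0) (h2 : vis p ξ₁ η₀ ≠ 0) : crossRatio ξ₀ η₀ ξ₁ η₁ =
      vis p ξ₀ ξ₁ * vis p η₀ η₁ / (vis p ξ₀ η₁ * vis p ξ₁ η₀) :=
  IsCrossRatio.unique (Classical.epsilon_spec (p := IsCrossRatio ξ₀ η₀ ξ₁ η₁)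
    ⟨_, hX.isCrossRatio p h1 h2⟩) (hX.isCrossRatio p h1 h2)

end Rays

/-! ### Geodesic lines of the hyperbolic plane -/

section Plane

/-- The exact form of Stewart's theorem for a geodesic line: along the line, the hyperbolic cosine
of the distance to any point is a combination of `exp` and `exp ∘ neg`. -/
def IsStewartLine {X : Type*} [MetricSpace X] (l : GeodesicLine X) : Prop :=
  ∀ y : X, ∃ A B : ℝ, ∀ t : ℝ, Real.cosh (dist y (l.1 t)) = A * Real.exp t + B * Real.exp (-t)

theorem IsStewartLine.flow {X : Type*} [MetricSpace X] {l : GeodesicLine X}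
    (hl : IsStewartLine l) (k : ℝ) : IsStewartLine (geodesicFlow k l) := by
  intro y
  obtain ⟨A, B, h⟩ := hl y
  refine ⟨A * Real.exp k, B * Real.exp (-k), fun t => ?_⟩
  change Real.cosh (dist y (l.1 (t + k))) = _
  rw [h, neg_add, Real.exp_add, Real.exp_add]
  ring

theorem posEnd_flow {X : Type*} [MetricSpace X] (l : GeodesicLine X) (k : ℝ) :
    (geodesicFlow k l).posEnd = l.posEnd :=
  endpoint_eq_iff.2 ⟨|k|, fun t => by
    change dist (l.1 (t + k)) (l.1 t) ≤ _
    rw [l.2.dist_eq, Real.dist_eq, add_sub_cancel_left]⟩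

theorem exp_combination_interpolate (A B L t : ℝ) :
    (A * Real.exp t + B * Real.exp (-t)) * Real.sinh L = (A + B) * Real.sinh (L - t) +
      (A * Real.exp L + B * Real.exp (-L)) * Real.sinh t := by
  simp only [Real.sinh_eq, neg_sub]
  rw [sub_eq_add_neg L t, sub_eq_add_neg t L, Real.exp_add, Real.exp_add]
  have h1 : Real.exp t * Real.exp (-t) = 1 := by rw [← Real.exp_add, add_neg_cancel, Real.exp_zero]
  have h2 : Real.exp L * Real.exp (-L) = 1 := by rw [← Real.exp_add, add_neg_cancel, Real.exp_zero]
  ring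

theorem IsStewartLine.stewart_eq {X : Type*} [MetricSpace X] {l : GeodesicLine X}
    (hl : IsStewartLine l) (y : X) (L t : ℝ) : Real.cosh (dist y (l.1 t)) * Real.sinh L =
      Real.cosh (dist y (l.1 0)) * Real.sinh (L - t) +
        Real.cosh (dist y (l.1 L)) * Real.sinh t := by
  obtain ⟨A, B, h⟩ := hl y
  rw [h, h, h, exp_combination_interpolate]
  simp

theorem IsStewartLine.eq_of_dist {X : Type*} [MetricSpace X] {l : GeodesicLine X}
    (hl : IsStewartLine l) {m : X} {L t : ℝ} (hL : L ≠ 0) (h0 : dist m (l.1 0) = |t|)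
    (h1 : dist m (l.1 L) = |L - t|) : m = l.1 t := by
  have h := hl.stewart_eq m L t
  rw [h0, h1, Real.cosh_abs, Real.cosh_abs] at h
  have e : Real.cosh t * Real.sinh (L - t) + Real.cosh (L - t) * Real.sinh t = Real.sinh L := by
    have := Real.sinh_add (L - t) t
    rw [sub_add_cancel] at this
    rw [this]; ring
  rw [e] at h
  have hs : Real.sinh L ≠ 0 := Real.sinh_ne_zero.2 hL
  have h2 : Real.cosh (dist m (l.1 t)) = 1 := mul_right_cancel₀ hs (h.trans (one_mul _).symm)
  by_contra hne
  exact (Real.one_lt_cosh.2 (dist_pos.2 hne).ne').ne' h2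

theorem eq_abs_of_cosh_eq {a b : ℝ} (ha : 0 ≤ a) (h : Real.cosh a = Real.cosh b) : a = |b| := by
  have h1 := (Real.cosh_le_cosh.1 h.le)
  have h2 := (Real.cosh_le_cosh.1 h.ge)
  rw [← abs_of_nonneg ha]
  exact le_antisymm h1 h2

/-- A bound for distances in terms of hyperbolic cosines. -/
theorem dist_le_two_mul_cosh {X : Type*} [MetricSpace X] (x y : X) :
    dist x y ≤ 2 * Real.cosh (dist x y) :=
  (by linarith [Real.add_one_le_exp (dist x y)] : dist x y ≤ Real.exp (dist x y)).trans
    (exp_le_two_mul_cosh _)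

theorem isometry_of_cosh_dist {c : ℝ → ℍ}
    (h : ∀ s t, Real.cosh (dist (c s) (c t)) = Real.cosh (s - t)) : Isometry c :=
  Isometry.of_dist_eq fun s t => eq_abs_of_cosh_eq dist_nonneg (h s t)

/-- The vertical line `t ↦ x + i eᵗ`. -/
noncomputable def upLine (x : ℝ) : GeodesicLine ℍ :=
  ⟨⟨fun t => ⟨⟨x, Real.exp t⟩, Real.exp_pos t⟩,
    (UpperHalfPlane.isometry_vertical_line x).continuous⟩,
    UpperHalfPlane.isometry_vertical_line x⟩

/-- The vertical line `t ↦ x + i e⁻ᵗ`. -/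
noncomputable def downLine (x : ℝ) : GeodesicLine ℍ :=
  ⟨⟨fun t => (upLine x).1 (-t), by fun_prop⟩,
    (upLine x).2.comp (Isometry.of_dist_eq fun a b => dist_neg_neg a b)⟩

theorem cosh_dist_semicircle (x R : ℝ) (hR : R ≠ 0) (z : ℍ) (t : ℝ)
    (h : 0 < (⟨x + R * Real.tanh t, |R| / Real.cosh t⟩ : ℂ).im) :
    Real.cosh (dist z ⟨⟨x + R * Real.tanh t, |R| / Real.cosh t⟩, h⟩) =
      (((z.re - x) ^ 2 + z.im ^ 2 + R ^ 2) * Real.cosh t - 2 * (z.re - x) * R * Real.sinh t) /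
        (2 * z.im * |R|) := by
  have hc := Real.cosh_pos t
  have hz := z.im_pos
  have hR' : 0 < |R| := abs_pos.2 hR
  rw [UpperHalfPlane.cosh_dist']
  change ((z.re - (x + R * Real.tanh t)) ^ 2 + z.im ^ 2 + (|R| / Real.cosh t) ^ 2) /
    (2 * z.im * (|R| / Real.cosh t)) = _
  rw [Real.tanh_eq_sinh_div_cosh, div_pow, sq_abs]
  have e : Real.sinh t ^ 2 = Real.cosh t ^ 2 - 1 := Real.sinh_sq t
  field_simp
  linear_combination R ^ 2 * e

/-- The geodesic line from `x - R` to `x + R`, a Euclidean semicircle of radius `|R|`. -/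
noncomputable def semicircleLine (x R : ℝ) (hR : R ≠ 0) : GeodesicLine ℍ :=
  have key : Isometry fun t : ℝ => (⟨⟨x + R * Real.tanh t, |R| / Real.cosh t⟩,
      div_pos (abs_pos.2 hR) (Real.cosh_pos t)⟩ : ℍ) := isometry_of_cosh_dist fun s t => by
    rw [cosh_dist_semicircle x R hR]
    change (((x + R * Real.tanh s - x) ^ 2 + (|R| / Real.cosh s) ^ 2 + R ^ 2) * Real.cosh t -
      2 * (x + R * Real.tanh s - x) * R * Real.sinh t) / (2 * (|R| / Real.cosh s) * |R|) = _
    have hs := Real.cosh_pos s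
    have hR' : 0 < |R| := abs_pos.2 hR
    rw [Real.tanh_eq_sinh_div_cosh, div_pow, sq_abs, add_sub_cancel_left, Real.cosh_sub,
      show 2 * (|R| / Real.cosh s) * |R| = 2 * R ^ 2 / Real.cosh s by
        rw [← sq_abs R]; ring]
    have e : Real.sinh s ^ 2 = Real.cosh s ^ 2 - 1 := Real.sinh_sq s
    field_simp
    linear_combination Real.cosh t * e
  ⟨⟨_, key.continuous⟩, key⟩

theorem isStewartLine_upLine (x : ℝ) : IsStewartLine (upLine x) := by
  intro z
  have hz := z.im_pos
  refine ⟨1 / (2 * z.im), ((z.re - x) ^ 2 + z.im ^ 2) / (2 * z.im), fun t => ?_⟩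
  rw [UpperHalfPlane.cosh_dist']
  change ((z.re - x) ^ 2 + z.im ^ 2 + Real.exp t ^ 2) / (2 * z.im * Real.exp t) = _
  rw [Real.exp_neg]
  have := Real.exp_pos t
  field_simp
  ring

theorem isStewartLine_downLine (x : ℝ) : IsStewartLine (downLine x) := by
  intro z
  obtain ⟨A, B, h⟩ := isStewartLine_upLine x z
  refine ⟨B, A, fun t => ?_⟩
  change Real.cosh (dist z ((upLine x).1 (-t))) = _
  rw [h, neg_neg, add_comm]

theorem isStewartLine_semicircleLine (x R : ℝ) (hR : R ≠ 0) :
    IsStewartLine (semicircleLine x R hR) := by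
  intro z
  refine ⟨((z.re - x) ^ 2 + z.im ^ 2 + R ^ 2 - 2 * (z.re - x) * R) / (4 * z.im * |R|),
    ((z.re - x) ^ 2 + z.im ^ 2 + R ^ 2 + 2 * (z.re - x) * R) / (4 * z.im * |R|), fun t => ?_⟩
  have hz := z.im_pos
  have hR' : 0 < |R| := abs_pos.2 hR
  refine (cosh_dist_semicircle x R hR z t _).trans ?_
  rw [Real.cosh_eq, Real.sinh_eq]
  field_simp
  ring

/-- The point `∞` of the boundary of the upper half-plane. -/
noncomputable def bdInfty : Boundary ℍ := (upLine 0).posEnd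

/-- The real point `s` of the boundary of the upper half-plane. -/
noncomputable def bdReal (s : ℝ) : Boundary ℍ := (downLine s).posEnd

theorem posEnd_upLine (x : ℝ) : (upLine x).posEnd = bdInfty := by
  refine endpoint_eq_iff.2 ⟨2 * ((x ^ 2 + 2) / 2), fun t => (dist_le_two_mul_cosh _ _).trans ?_⟩
  rw [UpperHalfPlane.cosh_dist']
  change 2 * (((x - 0) ^ 2 + Real.exp t ^ 2 + Real.exp t ^ 2) / (2 * Real.exp t * Real.exp t)) ≤ _
  have h1 : 1 ≤ Real.exp t := Real.one_le_exp t.2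
  gcongr 2 * ?_
  rw [div_le_div_iff₀ (by positivity) (by positivity)]
  nlinarith [sq_nonneg x, mul_nonneg (sq_nonneg x) (sub_nonneg.2 (one_le_pow₀ (n := 2) h1))]

theorem posEnd_semicircleLine (x R : ℝ) (hR : R ≠ 0) :
    (semicircleLine x R hR).posEnd = bdReal (x + R) := by
  have hR' : 0 < |R| := abs_pos.2 hR
  refine endpoint_eq_iff.2 ⟨2 * (|R| / 2 + |R| + 1 / (2 * |R|)),
    fun t => (dist_le_two_mul_cosh _ _).trans ?_⟩
  rw [UpperHalfPlane.cosh_dist']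
  change 2 * (((x + R * Real.tanh t - (x + R)) ^ 2 + (|R| / Real.cosh t) ^ 2 +
    Real.exp (-(t : ℝ)) ^ 2) / (2 * (|R| / Real.cosh t) * Real.exp (-(t : ℝ)))) ≤ _
  set u := Real.exp (-(t : ℝ)) with hu
  have hu0 : 0 < u := Real.exp_pos _
  have hu1 : u ≤ 1 := Real.exp_le_one_iff.2 (neg_nonpos.2 t.2)
  have hc0 : 0 < Real.cosh t := Real.cosh_pos _
  have hcu : Real.cosh t = (u⁻¹ + u) / 2 := by rw [Real.cosh_eq, hu, Real.exp_neg, inv_inv]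
  have hcu1 : Real.cosh t * u = (1 + u ^ 2) / 2 := by rw [hcu]; field_simp
  have e : x + R * Real.tanh t - (x + R) = - (R * u / Real.cosh t) := by
    have : Real.cosh t - Real.sinh t = u := Real.cosh_sub_sinh t
    rw [Real.tanh_eq_sinh_div_cosh]
    field_simp
    linear_combination -R * this
  rw [e, neg_sq, div_pow, div_pow, mul_pow, ← sq_abs R]
  have e2 : (|R| ^ 2 * u ^ 2 / Real.cosh t ^ 2 + |R| ^ 2 / Real.cosh t ^ 2 + u ^ 2) /
      (2 * (|R| / Real.cosh t) * u) =
      |R| / 2 * (u / Real.cosh t) + |R| / (2 * (Real.cosh t * u)) +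
        (Real.cosh t * u) / (2 * |R|) := by
    field_simp
  rw [e2, hcu1]
  have h1 : u / Real.cosh t ≤ 1 := (div_le_one hc0).2 (hu1.trans (Real.one_le_cosh _))
  have h2 : |R| / (2 * ((1 + u ^ 2) / 2)) ≤ |R| :=
    div_le_self hR'.le (by nlinarith [sq_nonneg u])
  have h3 : (1 + u ^ 2) / 2 ≤ 1 := by nlinarith
  gcongr
  nlinarith

/-- Any two points of the hyperbolic plane lie on a geodesic line, which satisfies Stewart's theorem
and whose endpoint is explicit. -/
theorem exists_line (p q : ℍ) : ∃ l : GeodesicLine ℍ, l.1 0 = p ∧ l.1 (dist p q) = q ∧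
    IsStewartLine l ∧ (l.posEnd = bdInfty ∨ ∃ s, l.posEnd = bdReal s) := by
  suffices h : ∃ (l : GeodesicLine ℍ) (s t : ℝ), s ≤ t ∧ l.1 s = p ∧ l.1 t = q ∧ IsStewartLine l ∧
      (l.posEnd = bdInfty ∨ ∃ s, l.posEnd = bdReal s) by
    obtain ⟨l, s, t, hst, rfl, rfl, h1, h2⟩ := h
    refine ⟨geodesicFlow s l, congrArg l.1 (zero_add s), congrArg l.1 ?_, h1.flow s, ?_⟩
    · rw [l.2.dist_eq, Real.dist_eq, abs_sub_comm, abs_of_nonneg (by linarith)]; ring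
    · rwa [posEnd_flow]
  have hp := p.im_pos
  have hq := q.im_pos
  rcases eq_or_ne p.re q.re with hre | hre
  · rcases le_total p.im q.im with him | him
    · refine ⟨upLine p.re, Real.log p.im, Real.log q.im, Real.log_le_log hp him, ?_, ?_,
        isStewartLine_upLine _, Or.inl (posEnd_upLine _)⟩
      · exact UpperHalfPlane.ext (Complex.ext rfl (Real.exp_log hp))
      · exact UpperHalfPlane.ext (Complex.ext hre (Real.exp_log hq))
    · refine ⟨downLine p.re, -Real.log p.im, -Real.log q.im, by
        linarith [Real.log_le_log hq him], ?_, ?_, isStewartLine_downLine _, Or.inr ⟨_, rfl⟩⟩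
      · exact UpperHalfPlane.ext (Complex.ext rfl
          ((congrArg Real.exp (neg_neg _)).trans (Real.exp_log hp)))
      · exact UpperHalfPlane.ext (Complex.ext hre
          ((congrArg Real.exp (neg_neg _)).trans (Real.exp_log hq)))
  · -- the centre of the Euclidean circle through `p` and `q`; the sign of `R` is that of
    -- `q.re - p.re`
    set x := (q.re ^ 2 + q.im ^ 2 - p.re ^ 2 - p.im ^ 2) / (2 * (q.re - p.re)) with hx
    have hne : q.re - p.re ≠ 0 := sub_ne_zero.2 hre.symm
    have hxeq : (p.re - x) ^ 2 + p.im ^ 2 = (q.re - x) ^ 2 + q.im ^ 2 := by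
      have : x * (2 * (q.re - p.re)) = q.re ^ 2 + q.im ^ 2 - p.re ^ 2 - p.im ^ 2 := by
        rw [hx, div_mul_cancel₀]; exact mul_ne_zero two_ne_zero hne
      linear_combination this
    clear_value x
    set r := √((p.re - x) ^ 2 + p.im ^ 2) with hr
    have hr0 : 0 < r := Real.sqrt_pos.2 (by positivity)
    have hrp : r ^ 2 = (p.re - x) ^ 2 + p.im ^ 2 := Real.sq_sqrt (by positivity)
    obtain ⟨σ, hσ, hσabs, hσs⟩ : ∃ σ : ℝ, σ ^ 2 = 1 ∧ |σ| = 1 ∧ 0 ≤ σ * (q.re - p.re) := by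
      rcases le_total 0 (q.re - p.re) with h | h
      · exact ⟨1, by norm_num, by norm_num, by linarith⟩
      · exact ⟨-1, by norm_num, by norm_num, by linarith⟩
    have hσ0 : σ ≠ 0 := by rintro rfl; norm_num at hσ
    have hR : σ * r ≠ 0 := mul_ne_zero hσ0 hr0.ne'
    have key : ∀ z : ℍ, r ^ 2 = (z.re - x) ^ 2 + z.im ^ 2 → ∃ t,
        (semicircleLine x (σ * r) hR).1 t = z ∧ σ * r * Real.tanh t = z.re - x := by
      intro z hz
      have hzi := z.im_pos
      have hs : Real.sinh (Real.arsinh (σ * (z.re - x) / z.im)) = σ * (z.re - x) / z.im :=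
        Real.sinh_arsinh _
      have hc : Real.cosh (Real.arsinh (σ * (z.re - x) / z.im)) = r / z.im := by
        rw [Real.cosh_arsinh, Real.sqrt_eq_iff_mul_self_eq (by positivity) (by positivity)]
        field_simp
        linear_combination (z.re - x) ^ 2 * hσ - hz
      have ht : σ * r * Real.tanh (Real.arsinh (σ * (z.re - x) / z.im)) = z.re - x := by
        rw [Real.tanh_eq_sinh_div_cosh, hs, hc]
        field_simp
        linear_combination (z.re - x) * hσ
      refine ⟨Real.arsinh (σ * (z.re - x) / z.im), UpperHalfPlane.ext (Complex.ext ?_ ?_), ht⟩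
      · change x + σ * r * Real.tanh _ = z.re
        rw [ht]; ring
      · change |σ * r| / Real.cosh _ = z.im
        rw [hc, abs_mul, hσabs, one_mul, abs_of_pos hr0]
        field_simp
    obtain ⟨s, hs, hs'⟩ := key p hrp
    obtain ⟨t, ht, ht'⟩ := key q (hrp.trans hxeq)
    refine ⟨_, s, t, ?_, hs, ht, isStewartLine_semicircleLine _ _ _,
      Or.inr ⟨_, posEnd_semicircleLine _ _ _⟩⟩
    have h1 : r * (Real.tanh t - Real.tanh s) = σ * (q.re - p.re) := by
      linear_combination σ * (ht' - hs') - r * (Real.tanh t - Real.tanh s) * hσ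
    have h2 : Real.tanh s ≤ Real.tanh t := by
      have : 0 ≤ Real.tanh t - Real.tanh s := nonneg_of_mul_nonneg_right (h1 ▸ hσs) hr0
      linarith
    by_contra hlt
    rw [not_le] at hlt
    rw [Real.tanh_eq_sinh_div_cosh, Real.tanh_eq_sinh_div_cosh,
      div_le_div_iff₀ (Real.cosh_pos _) (Real.cosh_pos _)] at h2
    have h3 := Real.sinh_sub s t
    have h4 := Real.sinh_pos_iff.2 (sub_pos.2 hlt)
    linarith

theorem hasStewart_upperHalfPlane : HasStewart ℍ where
  exists_segment x y := by
    obtain ⟨l, h0, h1, -⟩ := exists_line x y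
    exact ⟨l.1, ⟨dist_nonneg, fun s _ t _ => l.2.dist_eq s t⟩, h0, h1⟩
  stewart c L hc y t ht := by
    rcases hc.1.eq_or_lt with h0 | h0
    · obtain rfl : t = 0 := le_antisymm (h0 ▸ ht.2) ht.1
      simp [← h0]
    obtain ⟨l, hl0, hl1, hl, -⟩ := exists_line (c 0) (c L)
    rw [hc.dist_zero ⟨hc.1, le_rfl⟩] at hl1
    have : c t = l.1 t := hl.eq_of_dist h0.ne'
      (by rw [hl0, dist_comm, hc.dist_zero ht, abs_of_nonneg ht.1])
      (by rw [hl1, dist_comm, hc.dist_end ht, abs_of_nonneg (by linarith [ht.2])])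
    rw [this, hl.stewart_eq y L t, hl0, hl1]

/-- Every geodesic ray of the hyperbolic plane extends to a geodesic line. -/
theorem GeodesicRay.exists_line (c : GeodesicRay ℍ) : ∃ l : GeodesicLine ℍ,
    (∀ t : ℝ≥0, l.1 t = c.1 t) ∧ IsStewartLine l ∧
      (l.posEnd = bdInfty ∨ ∃ s, l.posEnd = bdReal s) := by
  obtain ⟨l, h0, h1, hl, he⟩ := CATBoundary.exists_line (c.1 0) (c.1 1)
  rw [c.dist_zero, NNReal.coe_one] at h1
  refine ⟨l, fun t => (hl.eq_of_dist one_ne_zero ?_ ?_).symm, hl, he⟩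
  · rw [h0, dist_comm, c.dist_zero, NNReal.abs_eq]
  · rw [h1, dist_comm, c.dist_eq, NNReal.coe_one]

theorem boundary_cases (ξ : Boundary ℍ) : ξ = bdInfty ∨ ∃ s, ξ = bdReal s := by
  obtain ⟨c, rfl⟩ := exists_endpoint_eq ξ
  obtain ⟨l, h, -, he⟩ := c.exists_line
  have : c.endpoint = l.posEnd := endpoint_eq_iff.2 ⟨0, fun t => by
    change dist (c.1 t) (l.1 t) ≤ 0
    rw [h, dist_self]⟩
  rwa [this]

/-- The rays to the real points of the boundary, normalised by a common horosphere at `∞`. -/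
noncomputable def downRay (s : ℝ) : GeodesicRay ℍ :=
  ⟨⟨fun t : ℝ≥0 => (downLine s).1 (t : ℝ), by fun_prop⟩,
    (downLine s).2.comp (Isometry.of_dist_eq fun _ _ => rfl)⟩

/-- The ray to `∞` on the imaginary axis. -/
noncomputable def upRay : GeodesicRay ℍ :=
  ⟨⟨fun t : ℝ≥0 => (upLine 0).1 (t : ℝ), by fun_prop⟩,
    (upLine 0).2.comp (Isometry.of_dist_eq fun _ _ => rfl)⟩

theorem horo_downRay (s t : ℝ) : (downRay s).horo (downRay t) = |s - t| := by
  rw [← abs_of_nonneg (GeodesicRay.horo_nonneg _ _), ← sq_eq_sq_iff_abs_eq_abs]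
  refine tendsto_nhds_unique (GeodesicRay.tendsto_cosh _ _) ?_
  have h := (tendsto_exp_neg_coe.pow 2).const_mul 2 |>.const_add ((s - t) ^ 2)
  rw [zero_pow two_ne_zero, mul_zero, add_zero] at h
  refine h.congr fun u => ?_
  rw [UpperHalfPlane.cosh_dist']
  change _ = 2 * (((s - t) ^ 2 + Real.exp (-(u : ℝ)) ^ 2 + Real.exp (-(u : ℝ)) ^ 2) /
    (2 * Real.exp (-(u : ℝ)) * Real.exp (-(u : ℝ)))) * Real.exp (-(2 * u : ℝ))
  have e : Real.exp (-(2 * u : ℝ)) = Real.exp (-(u : ℝ)) ^ 2 := by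
    rw [← Real.exp_nat_mul]; congr 1; push_cast; ring
  have := Real.exp_pos (-(u : ℝ))
  rw [e]
  field_simp
  ring

theorem horo_upRay (s : ℝ) : upRay.horo (downRay s) = 1 := by
  rw [← abs_of_nonneg (GeodesicRay.horo_nonneg _ _), ← abs_one, ← sq_eq_sq_iff_abs_eq_abs]
  refine tendsto_nhds_unique (GeodesicRay.tendsto_cosh _ _) ?_
  have h := ((tendsto_exp_neg_coe.pow 2).const_mul (s ^ 2)).add (tendsto_exp_neg_coe.pow 4)
    |>.const_add (1 ^ 2)
  rw [zero_pow two_ne_zero, mul_zero, zero_pow four_ne_zero, add_zero, add_zero] at h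
  refine h.congr fun u => ?_
  rw [UpperHalfPlane.cosh_dist']
  change _ = 2 * (((0 - s) ^ 2 + Real.exp (u : ℝ) ^ 2 + Real.exp (-(u : ℝ)) ^ 2) /
    (2 * Real.exp (u : ℝ) * Real.exp (-(u : ℝ)))) * Real.exp (-(2 * u : ℝ))
  have e : Real.exp (-(2 * u : ℝ)) = Real.exp (-(u : ℝ)) ^ 2 := by
    rw [← Real.exp_nat_mul]; congr 1; push_cast; ring
  have e' : Real.exp (u : ℝ) = (Real.exp (-(u : ℝ)))⁻¹ := by rw [Real.exp_neg, inv_inv]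
  have := Real.exp_pos (-(u : ℝ))
  rw [e, e']
  field_simp
  ring

theorem exists_comparison_point {a L D : ℝ} (ha : 0 ≤ a) (hL : 0 < L) (hD : 0 ≤ D)
    (h1 : |L - a| ≤ D) (h2 : D ≤ L + a) : ∃ w : ℍ, dist w ((upLine 0).1 0) = a ∧
      dist w ((upLine 0).1 L) = D := by
  have hs : 0 < Real.sinh L := Real.sinh_pos_iff.2 hL
  have c1 : Real.cosh (L - a) ≤ Real.cosh D := by
    rw [Real.cosh_le_cosh, abs_of_nonneg hD]; exact h1
  have c2 : Real.cosh D ≤ Real.cosh (L + a) := by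
    rw [Real.cosh_le_cosh, abs_of_nonneg hD, abs_of_nonneg (by linarith)]; exact h2
  rw [Real.cosh_sub] at c1
  rw [Real.cosh_add] at c2
  have eL1 : Real.exp L = Real.cosh L + Real.sinh L := (Real.cosh_add_sinh L).symm
  have eL2 : Real.exp (-L) = Real.cosh L - Real.sinh L := (Real.cosh_sub_sinh L).symm
  have hca := Real.cosh_pos a
  have hsa := Real.sinh_nonneg_iff.2 ha
  have hsca : Real.sinh a < Real.cosh a := Real.sinh_lt_cosh a
  set A := (Real.cosh D - Real.exp (-L) * Real.cosh a) / (2 * Real.sinh L) with hA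
  set B := (Real.exp L * Real.cosh a - Real.cosh D) / (2 * Real.sinh L) with hB
  have hA0 : 0 < A := by
    refine div_pos ?_ (by positivity)
    rw [eL2]; nlinarith
  have hAB : 1 ≤ 4 * A * B := by
    rw [hA, hB, show 4 * ((Real.cosh D - Real.exp (-L) * Real.cosh a) / (2 * Real.sinh L)) *
      ((Real.exp L * Real.cosh a - Real.cosh D) / (2 * Real.sinh L)) =
      ((Real.cosh D - Real.exp (-L) * Real.cosh a) * (Real.exp L * Real.cosh a - Real.cosh D)) /
        Real.sinh L ^ 2 by field_simp; ring, le_div_iff₀ (by positivity), eL1, eL2]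
    have e1 := Real.cosh_sq L
    have e2 := Real.cosh_sq a
    have h3 : 0 ≤ (Real.cosh L * Real.cosh a + Real.sinh L * Real.sinh a - Real.cosh D) *
        (Real.cosh D - (Real.cosh L * Real.cosh a - Real.sinh L * Real.sinh a)) :=
      mul_nonneg (by linarith) (by linarith)
    have h4 : (Real.cosh D - (Real.cosh L - Real.sinh L) * Real.cosh a) *
        ((Real.cosh L + Real.sinh L) * Real.cosh a - Real.cosh D) - 1 * Real.sinh L ^ 2 =
        (Real.cosh L * Real.cosh a + Real.sinh L * Real.sinh a - Real.cosh D) *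
        (Real.cosh D - (Real.cosh L * Real.cosh a - Real.sinh L * Real.sinh a)) := by
      linear_combination (Real.sinh L ^ 2) * e2
    linarith
  have hx : 0 ≤ B / A - 1 / (4 * A ^ 2) := by
    rw [show B / A - 1 / (4 * A ^ 2) = (4 * A * B - 1) / (4 * A ^ 2) by field_simp]
    exact div_nonneg (by linarith) (by positivity)
  have key : ∀ t, Real.cosh (dist (⟨⟨√(B / A - 1 / (4 * A ^ 2)), 1 / (2 * A)⟩, by positivity⟩ : ℍ)
      ((upLine 0).1 t)) = A * Real.exp t + B * Real.exp (-t) := fun t => by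
    rw [UpperHalfPlane.cosh_dist']
    change ((√(B / A - 1 / (4 * A ^ 2)) - 0) ^ 2 + (1 / (2 * A)) ^ 2 + Real.exp t ^ 2) /
      (2 * (1 / (2 * A)) * Real.exp t) = _
    rw [sub_zero, Real.sq_sqrt hx, Real.exp_neg]
    have := Real.exp_pos t
    field_simp
    ring
  refine ⟨_, (eq_abs_of_cosh_eq dist_nonneg ((key 0).trans ?_)).trans (abs_of_nonneg ha),
    (eq_abs_of_cosh_eq dist_nonneg ((key L).trans ?_)).trans (abs_of_nonneg hD)⟩
  · rw [hA, hB, eL1, eL2]; simp only [neg_zero, Real.exp_zero]; field_simp; ring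
  · rw [hA, hB, eL1, eL2]; field_simp; ring

theorem IsCATNegOne.hasStewart {X : Type*} [MetricSpace X] (hX : IsCATNegOne X) : HasStewart X where
  exists_segment := hX.exists_segment
  stewart c L hc y t ht := by
    rcases hc.1.eq_or_lt with h0 | h0
    · obtain rfl : t = 0 := le_antisymm (h0 ▸ ht.2) ht.1
      simp [← h0]
    obtain ⟨c', hc', hc'0, hc'1⟩ := hX.exists_segment (c 0) y
    have hL := hc.dist_zero ⟨hc.1, le_rfl⟩
    obtain ⟨w, hw0, hwL⟩ := exists_comparison_point (a := dist (c 0) y) (L := L)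
      (D := dist y (c L)) dist_nonneg h0 dist_nonneg
      (by
        have := abs_dist_sub_le (c L) y (c 0)
        rwa [dist_comm (c L) (c 0), hL, dist_comm y (c 0), dist_comm (c L) y] at this)
      (by
        have := dist_triangle y (c 0) (c L)
        rw [hL, dist_comm y (c 0)] at this
        linarith)
    obtain ⟨l, hl0, hl1, -⟩ := exists_line ((upLine 0).1 0) w
    rw [dist_comm, hw0] at hl1
    have h := hX.comparison c' c l.1 (upLine 0).1 (dist (c 0) y) L hc' hc hc'0
      (by simpa using Isometry.isGeodesicSegment l.2 dist_nonneg 0)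
      (by simpa using Isometry.isGeodesicSegment (upLine 0).2 h0.le 0) hl0
      (by rw [hl1, hwL, hc'1]) _ ⟨dist_nonneg, le_rfl⟩ t ht
    rw [hc'1, hl1] at h
    have e := (isStewartLine_upLine 0).stewart_eq w L t
    rw [hw0, hwL, dist_comm (c 0) y] at e
    rw [← e]
    gcongr
    rwa [Real.cosh_le_cosh, abs_of_nonneg dist_nonneg, abs_of_nonneg dist_nonneg]

end Plane

/-! ### Rays and lines in proper spaces -/

section Limits

variable {X : Type*} [MetricSpace X]

theorem exists_limit_isometry [ProperSpace X] {T ι : Type*} [PseudoMetricSpace T]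
    (U : Ultrafilter ι)
    (c : ι → T → X) (x : X) (hb : ∀ t, ∃ R, ∀ᶠ n in U, dist (c n t) x ≤ R)
    (hd : ∀ s t, ∀ᶠ n in U, dist (c n s) (c n t) = dist s t) :
    ∃ c' : T → X, Isometry c' ∧ ∀ t, Tendsto (fun n => c n t) U (𝓝 (c' t)) := by
  have h : ∀ t, ∃ y, Tendsto (fun n => c n t) U (𝓝 y) := fun t => by
    obtain ⟨R, hR⟩ := hb t
    obtain ⟨y, -, hy⟩ := (isCompact_closedBall x R).ultrafilter_le_nhds' (U.map fun n => c n t) hR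
    exact ⟨y, hy⟩
  choose c' hc' using h
  refine ⟨c', Isometry.of_dist_eq fun s t => ?_, hc'⟩
  exact tendsto_nhds_unique ((hc' s).dist (hc' t))
    (tendsto_const_nhds.congr' ((hd s t).mono fun n hn => hn.symm))

theorem eventually_le_natCast (a : ℝ) : ∀ᶠ n : ℕ in hyperfilter ℕ, a ≤ n :=
  Nat.hyperfilter_le_atTop ((tendsto_natCast_atTop_atTop (R := ℝ)).eventually_ge_atTop a)

theorem HasStewart.exists_ray [ProperSpace X] (hX : HasStewart X) (p : X) (ξ : Boundary X) :
    ∃ c : GeodesicRay X, c.1 0 = p ∧ c.endpoint = ξ := by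
  obtain ⟨d, rfl⟩ := exists_endpoint_eq ξ
  choose σ hσ hσ0 hσ1 using fun n : ℕ => hX.exists_segment p (d.1 n)
  have hlen : ∀ n : ℕ, (n : ℝ) - dist p (d.1 0) ≤ dist p (d.1 n) := fun n => by
    have := dist_triangle (d.1 0) p (d.1 n)
    rw [d.dist_zero, dist_comm _ p] at this
    push_cast at this
    linarith
  have hev : ∀ t : ℝ≥0, ∀ᶠ n : ℕ in hyperfilter ℕ, (t : ℝ) ∈ Set.Icc 0 (dist p (d.1 n)) := fun t =>
    (eventually_le_natCast (t + dist p (d.1 0))).mono fun n hn => ⟨t.2, by linarith [hlen n]⟩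
  obtain ⟨c, hc, hlim⟩ := exists_limit_isometry (hyperfilter ℕ) (fun n (t : ℝ≥0) => σ n t) p
    (fun t => ⟨t, (hev t).mono fun n hn => by
      have := (hσ n).dist_zero hn
      rw [hσ0, dist_comm] at this
      exact this.le⟩)
    (fun s t => ((hev s).and (hev t)).mono fun n hn => (hσ n).2 _ hn.1 _ hn.2)
  refine ⟨⟨⟨c, hc.continuous⟩, hc⟩, ?_, ?_⟩
  · refine tendsto_nhds_unique (hlim 0) ?_
    simp only [NNReal.coe_zero, hσ0, tendsto_const_nhds]
  · refine endpoint_eq_iff.2 ⟨3 * dist p (d.1 0), fun t => ?_⟩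
    refine le_of_tendsto ((hlim t).dist tendsto_const_nhds) ?_
    filter_upwards [hev t, eventually_le_natCast t] with n hn hn'
    have h := hX.fellow_travel (hσ n) (d.isGeodesicSegment (Nat.cast_nonneg n)) (t := t)
      (by rw [hσ1, Real.toNNReal_natCast]) hn ⟨t.2, hn'⟩
    simpa [hσ0] using h

/-- Comparison of the horospherical product of two rays issuing from the same point with the
distances between them. Together with `GeodesicRay.horo_le` it shows that the horospherical product
is determined by initial segments up to an error which is uniformly small. -/
theorem HasStewart.sinh_le_horo (hX : HasStewart X) {c d : GeodesicRay X} (h0 : c.1 0 = d.1 0)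
    (t : ℝ≥0) : Real.sinh (dist (c.1 t) (d.1 t) / 2) ≤ Real.sinh t * c.horo d := by
  have ht : 0 ≤ Real.sinh t := Real.sinh_nonneg_iff.2 t.2
  refine le_of_sq_le_sq ?_ (mul_nonneg ht (c.horo_nonneg d))
  have e : Real.cosh (dist (c.1 t) (d.1 t)) - 1 = 2 * Real.sinh (dist (c.1 t) (d.1 t) / 2) ^ 2 := by
    have h1 := Real.cosh_two_mul (dist (c.1 t) (d.1 t) / 2)
    have h2 := Real.cosh_sq (dist (c.1 t) (d.1 t) / 2)
    rw [mul_div_cancel₀ _ two_ne_zero] at h1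
    linarith
  have l1 : Tendsto (fun T : ℝ≥0 => ((1 - Real.exp (-(T : ℝ)) ^ 2) / 2) ^ 2 *
      (2 * (Real.cosh (dist (c.1 t) (d.1 t)) - 1))) atTop
      (𝓝 (((1 - 0 ^ 2) / 2) ^ 2 * (2 * (Real.cosh (dist (c.1 t) (d.1 t)) - 1)))) :=
    (((tendsto_exp_neg_coe.pow 2).const_sub 1).div_const 2 |>.pow 2).mul_const _
  have l2 := (((c.tendsto_cosh d).sub ((tendsto_exp_neg_coe.pow 2).const_mul 2))).const_mul
    (Real.sinh t ^ 2)
  have key := le_of_tendsto_of_tendsto l1 l2 ((eventually_ge_atTop t).mono fun T hT => by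
    have h := hX.thin (c.isGeodesicSegment (a := T) T.2) (d.isGeodesicSegment (a := T) T.2) (t := t)
      (by simpa using h0) ⟨t.2, hT⟩
    simp only [Real.toNNReal_coe] at h
    have hm := mul_le_mul_of_nonneg_right h (by positivity : 0 ≤ 2 * Real.exp (-(T : ℝ)) ^ 2)
    have e1 : Real.sinh T * Real.exp (-(T : ℝ)) = (1 - Real.exp (-(T : ℝ)) ^ 2) / 2 := by
      rw [Real.sinh_eq, sub_div, sub_mul, div_mul_eq_mul_div, ← Real.exp_add, add_neg_cancel,
        Real.exp_zero]
      ring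
    have e2 : Real.exp (-(2 * T : ℝ)) = Real.exp (-(T : ℝ)) ^ 2 := by
      rw [← Real.exp_nat_mul]; congr 1; push_cast; ring
    dsimp only
    rw [← e1, e2]
    linarith)
  rw [e] at key
  rw [zero_pow two_ne_zero, mul_zero, sub_zero] at key
  rw [mul_pow]
  linarith

theorem HasStewart.eq_of_horo_eq_zero (hX : HasStewart X) {c d : GeodesicRay X}
    (h0 : c.1 0 = d.1 0) (h : c.horo d = 0) : c = d := by
  refine Subtype.ext (ContinuousMap.ext fun t => ?_)
  have h1 := hX.sinh_le_horo h0 t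
  rw [h, mul_zero] at h1
  have h2 := Real.sinh_nonpos_iff.1 h1
  exact dist_le_zero.1 (by linarith)

/-- The geodesic ray from `p` to the boundary point `ξ`. -/
noncomputable def HasStewart.ray [ProperSpace X] (hX : HasStewart X) (p : X) (ξ : Boundary X) :
    GeodesicRay X := (hX.exists_ray p ξ).choose

theorem HasStewart.ray_zero [ProperSpace X] (hX : HasStewart X) (p : X) (ξ : Boundary X) :
    (hX.ray p ξ).1 0 = p := (hX.exists_ray p ξ).choose_spec.1

theorem HasStewart.endpoint_ray [ProperSpace X] (hX : HasStewart X) (p : X) (ξ : Boundary X) :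
    (hX.ray p ξ).endpoint = ξ := (hX.exists_ray p ξ).choose_spec.2

theorem HasStewart.ray_eq [ProperSpace X] (hX : HasStewart X) (c : GeodesicRay X) :
    hX.ray (c.1 0) c.endpoint = c :=
  hX.eq_of_horo_eq_zero (hX.ray_zero _ _) (GeodesicRay.horo_eq_zero (hX.endpoint_ray _ _))

theorem HasStewart.vis_eq_horo [ProperSpace X] (hX : HasStewart X) (p : X) (ξ η : Boundary X) :
    vis p ξ η = (hX.ray p ξ).horo (hX.ray p η) := by
  have h1 := (hX.ray p ξ).busemannExp_zero
  have h2 := (hX.ray p η).busemannExp_zero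
  rw [hX.ray_zero] at h1 h2
  have := hX.vis_endpoint p (hX.ray p ξ) (hX.ray p η)
  rwa [hX.endpoint_ray, hX.endpoint_ray, h1, h2, one_mul, div_one] at this

theorem HasStewart.eq_of_vis_eq_zero [ProperSpace X] (hX : HasStewart X) {p : X} {ξ η : Boundary X}
    (h : vis p ξ η = 0) : ξ = η := by
  rw [hX.vis_eq_horo] at h
  rw [← hX.endpoint_ray p ξ, ← hX.endpoint_ray p η,
    hX.eq_of_horo_eq_zero ((hX.ray_zero p ξ).trans (hX.ray_zero p η).symm) h]

theorem HasStewart.vis_pos [ProperSpace X] (hX : HasStewart X) (p : X) {ξ η : Boundary X}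
    (h : ξ ≠ η) : 0 < vis p ξ η :=
  (vis_nonneg p ξ η).lt_of_ne fun h0 => h (hX.eq_of_vis_eq_zero h0.symm)

/-- Visual metrics are continuous with respect to the convergence of rays. -/
theorem HasStewart.tendsto_horo_of_tendsto (hX : HasStewart X) {ι : Type*} {l : Filter ι}
    {c d : ι → GeodesicRay X} {c' d' : GeodesicRay X} (h0 : ∀ k, (c k).1 0 = (d k).1 0)
    (h0' : c'.1 0 = d'.1 0)
    (hc : ∀ t, Tendsto (fun k => (c k).1 t) l (𝓝 (c'.1 t)))
    (hd : ∀ t, Tendsto (fun k => (d k).1 t) l (𝓝 (d'.1 t))) :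
    Tendsto (fun k => (c k).horo (d k)) l (𝓝 (c'.horo d')) := by
  have bound : ∀ (a b : GeodesicRay X), a.1 0 = b.1 0 → ∀ t : ℝ≥0, 0 < t →
      dist (a.horo b) (Real.exp (dist (a.1 t) (b.1 t) / 2 - t)) ≤ 1 / (2 * Real.sinh t) := by
    intro a b hab t ht
    have hs : 0 < Real.sinh t := Real.sinh_pos_iff.2 (by exact_mod_cast ht)
    have h1 := a.horo_le b t t
    rw [show (dist (a.1 t) (b.1 t) - t - t) / 2 = dist (a.1 t) (b.1 t) / 2 - t by ring] at h1
    have h2 := hX.sinh_le_horo hab t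
    rw [Real.dist_eq, abs_sub_comm, abs_of_nonneg (by linarith), le_div_iff₀ (by positivity)]
    set D := dist (a.1 t) (b.1 t) / 2 with hD
    have hD0 : 0 ≤ D := by positivity
    have e : Real.exp (D - t) * (2 * Real.sinh t) = Real.exp D - Real.exp (D - 2 * t) := by
      rw [Real.sinh_eq, mul_div_cancel₀ _ two_ne_zero, mul_sub, ← Real.exp_add, ← Real.exp_add]
      congr 2 <;> ring
    have e2 := Real.sinh_eq D
    have e3 : Real.exp (-D) ≤ 1 := Real.exp_le_one_iff.2 (by linarith)
    nlinarith [Real.exp_pos (D - 2 * t)]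
  rw [Metric.tendsto_nhds]
  intro ε hε
  have hlim : Tendsto (fun t : ℝ≥0 => 1 / (2 * Real.sinh t)) atTop (𝓝 0) := by
    refine squeeze_zero (fun t => ?_) (fun t => ?_)
      (tendsto_inv_atTop_zero.comp (NNReal.tendsto_coe_atTop.2 tendsto_id))
    · have := Real.sinh_nonneg_iff.2 t.2
      change 0 ≤ Real.sinh t at this
      positivity
    · rcases eq_or_ne t 0 with rfl | ht
      · simp
      · have ht' : (0 : ℝ) < t := NNReal.coe_pos.2 (pos_iff_ne_zero.2 ht)
        have := Real.self_le_sinh_iff.2 t.2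
        change (t : ℝ) ≤ Real.sinh t at this
        simp only [Function.comp_apply, id]
        rw [one_div]
        gcongr
        linarith
  obtain ⟨t, ht0, ht⟩ := ((eventually_gt_atTop 0).and
    (hlim.eventually (gt_mem_nhds (by positivity : 0 < ε / 3)))).exists
  have hconv : Tendsto (fun k => Real.exp (dist ((c k).1 t) ((d k).1 t) / 2 - t)) l
      (𝓝 (Real.exp (dist (c'.1 t) (d'.1 t) / 2 - t))) :=
    (Real.continuous_exp.tendsto _).comp ((((hc t).dist (hd t)).div_const 2).sub_const _)
  filter_upwards [Metric.tendsto_nhds.1 hconv (ε / 3) (by positivity)] with k hk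
  have b1 := bound _ _ (h0 k) t ht0
  have b2 := bound _ _ h0' t ht0
  rw [dist_comm] at b2
  have := dist_triangle4 ((c k).horo (d k)) (Real.exp (dist ((c k).1 t) ((d k).1 t) / 2 - t))
    (Real.exp (dist (c'.1 t) (d'.1 t) / 2 - t)) (c'.horo d')
  linarith

/-- Pointwise convergence of the rays from `p`; it implies convergence in the cone topology. -/
def HasStewart.RayTendsto [ProperSpace X] (hX : HasStewart X) {ι : Type*} (p : X)
    (u : ι → Boundary X) (l : Filter ι) (ξ : Boundary X) : Prop :=
  ∀ t, Tendsto (fun k => (hX.ray p (u k)).1 t) l (𝓝 ((hX.ray p ξ).1 t))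

theorem HasStewart.RayTendsto.vis [ProperSpace X] {hX : HasStewart X} {ι : Type*} {p : X}
    {u v : ι → Boundary X} {l : Filter ι} {ξ η : Boundary X} (hu : hX.RayTendsto p u l ξ)
    (hv : hX.RayTendsto p v l η) :
    Tendsto (fun k => vis p (u k) (v k)) l (𝓝 (vis p ξ η)) := by
  simp only [hX.vis_eq_horo]
  exact hX.tendsto_horo_of_tendsto (fun k => by rw [hX.ray_zero, hX.ray_zero])
    (by rw [hX.ray_zero, hX.ray_zero]) hu hv

theorem HasStewart.exists_rayTendsto [ProperSpace X] (hX : HasStewart X) {ι : Type*} (p : X)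
    (U : Ultrafilter ι) (u : ι → Boundary X) : ∃ ξ, hX.RayTendsto p u U ξ := by
  obtain ⟨c, hc, hlim⟩ := exists_limit_isometry U (fun k => (hX.ray p (u k)).1) p
    (fun t => ⟨t, Eventually.of_forall fun k => by
      have := (hX.ray p (u k)).dist_zero t
      rw [hX.ray_zero, dist_comm] at this
      exact this.le⟩) (fun s t => Eventually.of_forall fun k => (hX.ray p (u k)).2.dist_eq s t)
  have hc0 : c 0 = p := by
    refine tendsto_nhds_unique (hlim 0) ?_
    simp only [hX.ray_zero, tendsto_const_nhds]
  refine ⟨GeodesicRay.endpoint ⟨⟨c, hc.continuous⟩, hc⟩, fun t => ?_⟩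
  have h := hX.ray_eq ⟨⟨c, hc.continuous⟩, hc⟩
  simp only [ContinuousMap.coe_mk, hc0] at h
  rw [h]
  exact hlim t

theorem HasStewart.RayTendsto.unique [ProperSpace X] {hX : HasStewart X} {ι : Type*} {p : X}
    {u : ι → Boundary X} {l : Filter ι} [l.NeBot] {ξ η : Boundary X} (hξ : hX.RayTendsto p u l ξ)
    (hη : hX.RayTendsto p u l η) : ξ = η := by
  rw [← hX.endpoint_ray p ξ, ← hX.endpoint_ray p η]
  congr 1
  exact Subtype.ext (ContinuousMap.ext fun t => tendsto_nhds_unique (hξ t) (hη t))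

theorem HasStewart.RayTendsto.tendsto [ProperSpace X] {hX : HasStewart X} {ι : Type*} {p : X}
    {u : ι → Boundary X} {l : Filter ι} {ξ : Boundary X} (h : hX.RayTendsto p u l ξ) :
    Tendsto u l (@nhds _ (coneTopology p) ξ) := by
  have hr : Tendsto (fun k => (⟨hX.ray p (u k), hX.ray_zero _ _⟩ :
      {c : GeodesicRay X // c.1 0 = p})) l (𝓝 ⟨hX.ray p ξ, hX.ray_zero _ _⟩) := by
    rw [tendsto_subtype_rng, tendsto_subtype_rng]
    rw [ContinuousMap.isUniformEmbedding_toUniformOnFunIsCompact.isInducing.tendsto_nhds_iff]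
    have hUE : UniformEquicontinuous fun k => ((hX.ray p (u k)).1 : ℝ≥0 → X) :=
      LipschitzWith.uniformEquicontinuous _ 1 fun k => (hX.ray p (u k)).2.lipschitz
    refine (EquicontinuousOn.tendsto_uniformOnFun_iff_pi (fun K hK => hK)
      (Set.eq_univ_of_forall fun t => ⟨{t}, isCompact_singleton, rfl⟩)
      (fun K _ => hUE.equicontinuous.equicontinuousOn K) l _).2 ?_
    exact tendsto_pi_nhds.2 h
  let _ : TopologicalSpace (Boundary X) := coneTopology p
  have hcont : Continuous fun c : {c : GeodesicRay X // c.1 0 = p} => c.1.endpoint :=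
    continuous_coinduced_rng
  have := (hcont.tendsto _).comp hr
  simpa only [Function.comp_def, hX.endpoint_ray] using this

/-- The geodesic rays issuing from `p`. -/
abbrev RaysFrom (p : X) : Type _ := {c : GeodesicRay X // c.1 0 = p}

theorem HasStewart.exists_countable_vis_dense [ProperSpace X] (hX : HasStewart X) (p : X) :
    ∃ Z : Set (Boundary X), Z.Countable ∧ ∀ ξ, ∀ δ > 0, ∃ z ∈ Z, vis p ξ z < δ := by
  have : SecondCountableTopology (GeodesicRay X) :=
    TopologicalSpace.Subtype.secondCountableTopology _
  have : SecondCountableTopology (RaysFrom p) :=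
    TopologicalSpace.Subtype.secondCountableTopology _
  obtain ⟨S, hS, hSd⟩ := TopologicalSpace.exists_countable_dense (RaysFrom p)
  refine ⟨(fun c : RaysFrom p => c.1.endpoint) '' S, hS.image _, fun ξ δ hδ => ?_⟩
  have hcont : Continuous fun c : RaysFrom p => (hX.ray p ξ).horo c.1 := by
    rw [continuous_iff_continuousAt]
    intro c
    refine hX.tendsto_horo_of_tendsto (fun k => (hX.ray_zero p ξ).trans k.2.symm)
      ((hX.ray_zero p ξ).trans c.2.symm) (fun t => tendsto_const_nhds) (fun t => ?_)
    exact Continuous.tendsto (f := fun k : RaysFrom p => k.1.1 t) (by fun_prop) c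
  have hmem : (⟨hX.ray p ξ, hX.ray_zero p ξ⟩ : RaysFrom p) ∈
      {c : RaysFrom p | (hX.ray p ξ).horo c.1 < δ} := by
    change (hX.ray p ξ).horo (hX.ray p ξ) < δ
    rwa [GeodesicRay.horo_eq_zero rfl]
  obtain ⟨c, hc, hcS⟩ := hSd.inter_open_nonempty _ (isOpen_lt hcont continuous_const) ⟨_, hmem⟩
  refine ⟨_, ⟨c, hcS, rfl⟩, ?_⟩
  have h := hX.ray_eq c.1
  rw [c.2] at h
  rw [hX.vis_eq_horo, h]
  exact hc

end Limits

/-! ### Geodesic lines and their endpoints -/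

section Lines

variable {X : Type*} [MetricSpace X]

/-- The positive half of a geodesic line. -/
def GeodesicLine.posRay (l : GeodesicLine X) : GeodesicRay X :=
  ⟨⟨fun t : ℝ≥0 => l.1 (t : ℝ), by fun_prop⟩, l.2.comp (Isometry.of_dist_eq fun _ _ => rfl)⟩

/-- The negative half of a geodesic line. -/
def GeodesicLine.negRay (l : GeodesicLine X) : GeodesicRay X :=
  ⟨⟨fun t : ℝ≥0 => l.1 (-(t : ℝ)), by fun_prop⟩,
    l.2.comp (Isometry.of_dist_eq fun a b => by rw [dist_neg_neg]; rfl)⟩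

theorem GeodesicLine.endpoint_posRay (l : GeodesicLine X) : l.posRay.endpoint = l.posEnd := rfl

theorem GeodesicLine.endpoint_negRay (l : GeodesicLine X) : l.negRay.endpoint = l.negEnd := rfl

theorem GeodesicLine.dist_eq (l : GeodesicLine X) (s t : ℝ) : dist (l.1 s) (l.1 t) = |s - t| := by
  rw [l.2.dist_eq, Real.dist_eq]

theorem negEnd_flow (l : GeodesicLine X) (k : ℝ) : (geodesicFlow k l).negEnd = l.negEnd :=
  endpoint_eq_iff.2 ⟨|k|, fun t => by
    change dist (l.1 (-t + k)) (l.1 (-t)) ≤ _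
    rw [l.dist_eq, add_sub_cancel_left]⟩

theorem GeodesicLine.horo_negRay (l : GeodesicLine X) : l.posRay.horo l.negRay = 1 := by
  refine tendsto_nhds_unique (l.posRay.tendsto_horo_diag l.negRay) ?_
  refine tendsto_const_nhds.congr fun t => ?_
  change 1 = Real.exp (dist (l.1 t) (l.1 (-t)) / 2 - t)
  rw [l.dist_eq, abs_of_nonneg (by linarith [NNReal.coe_nonneg t]), eq_comm, Real.exp_eq_one_iff]
  ring

theorem GeodesicLine.busemannExp_posRay (l : GeodesicLine X) (t : ℝ) :
    l.posRay.busemannExp (l.1 t) = Real.exp (-t / 2) := by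
  refine tendsto_nhds_unique (l.posRay.tendsto_busemannExp _) (tendsto_const_nhds.congr' ?_)
  filter_upwards [(NNReal.tendsto_coe_atTop.2 tendsto_id).eventually_ge_atTop t] with s hs
  simp only [id] at hs
  change _ = Real.exp ((dist (l.1 t) (l.1 s) - s) / 2)
  rw [l.dist_eq, abs_sub_comm, abs_of_nonneg (sub_nonneg.2 hs)]
  congr 1; ring

theorem GeodesicLine.busemannExp_negRay (l : GeodesicLine X) (t : ℝ) :
    l.negRay.busemannExp (l.1 t) = Real.exp (t / 2) := by
  refine tendsto_nhds_unique (l.negRay.tendsto_busemannExp _) (tendsto_const_nhds.congr' ?_)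
  filter_upwards [(NNReal.tendsto_coe_atTop.2 tendsto_id).eventually_ge_atTop (-t)] with s hs
  simp only [id] at hs
  change _ = Real.exp ((dist (l.1 t) (l.1 (-s)) - s) / 2)
  rw [l.dist_eq, abs_of_nonneg (by linarith)]
  congr 1; ring

theorem HasStewart.vis_line (hX : HasStewart X) (l : GeodesicLine X) (t : ℝ) :
    vis (l.1 t) l.posEnd l.negEnd = 1 := by
  rw [← l.endpoint_posRay, ← l.endpoint_negRay, hX.vis_endpoint, l.horo_negRay,
    l.busemannExp_posRay, l.busemannExp_negRay, ← Real.exp_add, ← add_div, neg_add_cancel, zero_div,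
    Real.exp_zero, div_one]

/-- The conformal factor at `ξ` of the visual metric seen from `q` with respect to the one seen from
`p`, in other words `exp ((b(p) - b(q)) / 2)` for a Busemann function `b` centred at `ξ`. -/
noncomputable def conf (p q : X) (ξ : Boundary X) : ℝ :=
  GeodesicRay.busemannExp (Quotient.out ξ) p / GeodesicRay.busemannExp (Quotient.out ξ) q

theorem conf_pos (p q : X) (ξ : Boundary X) : 0 < conf p q ξ :=
  div_pos (GeodesicRay.busemannExp_pos _ _) (GeodesicRay.busemannExp_pos _ _)

theorem conf_mul (p q r : X) (ξ : Boundary X) : conf p q ξ * conf q r ξ = conf p r ξ := by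
  simp only [conf]
  have := GeodesicRay.busemannExp_pos (Quotient.out ξ) q
  have := GeodesicRay.busemannExp_pos (Quotient.out ξ) r
  field_simp

theorem vis_conf (p q : X) (ξ η : Boundary X) :
    vis q ξ η = conf p q ξ * conf p q η * vis p ξ η := by
  simp only [vis, conf]
  set c : GeodesicRay X := Quotient.out ξ
  set d : GeodesicRay X := Quotient.out η
  have := c.busemannExp_pos p
  have := d.busemannExp_pos p
  have := c.busemannExp_pos q
  have := d.busemannExp_pos q
  field_simp

theorem HasStewart.conf_line (hX : HasStewart X) (l : GeodesicLine X) (s t : ℝ) :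
    conf (l.1 s) (l.1 t) l.posEnd = Real.exp ((t - s) / 2) := by
  set c : GeodesicRay X := Quotient.out l.posEnd with hc
  have hce : l.posRay.endpoint = c.endpoint := (out_endpoint l.posEnd).symm
  have h : ∀ u, c.busemannExp (l.1 u) = c.horo l.negRay * Real.exp (-u / 2) := fun u => by
    have := hX.horo_congr hce l.negRay (l.1 u)
    rwa [l.horo_negRay, one_mul, l.busemannExp_posRay] at this
  have hpos : 0 < c.horo l.negRay := by
    have := c.busemannExp_pos (l.1 0)
    rw [h] at this
    exact pos_of_mul_pos_left this (Real.exp_pos _).le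
  change c.busemannExp _ / c.busemannExp _ = _
  rw [h, h, mul_div_mul_left _ _ hpos.ne', ← Real.exp_sub]
  congr 1; ring

/-- Points of the geodesic line between `ξ` and `η` (those from which `ξ` and `η` are opposite) are
determined by the Busemann function of `ξ`: otherwise the inequality `GeodesicRay.horo_le_mul` would
be violated at a midpoint, as Busemann functions are strictly convex on that scale. -/
theorem HasStewart.eq_of_conf_eq_one (hX : HasStewart X) {p q : X} {ξ η : Boundary X}
    (hp : vis p ξ η = 1) (hq : vis q ξ η = 1) (h : conf p q ξ = 1) : p = q := by
  have hη : conf p q η = 1 := by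
    have := vis_conf p q ξ η
    rwa [hp, hq, h, one_mul, mul_one, eq_comm] at this
  set c : GeodesicRay X := Quotient.out ξ with hc
  set d : GeodesicRay X := Quotient.out η with hd
  have hcq : c.busemannExp p = c.busemannExp q :=
    (div_eq_one_iff_eq (c.busemannExp_pos q).ne').1 h
  have hdq : d.busemannExp p = d.busemannExp q :=
    (div_eq_one_iff_eq (d.busemannExp_pos q).ne').1 hη
  have hE : c.horo d = c.busemannExp p * d.busemannExp p :=
    (div_eq_one_iff_eq (mul_pos (c.busemannExp_pos p) (d.busemannExp_pos p)).ne').1 hp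
  by_contra hne
  have hL : 0 < dist p q := dist_pos.2 hne
  obtain ⟨γ, hγ, h0, h1⟩ := hX.exists_segment p q
  set L := dist p q
  have hs : 0 < Real.sinh (L / 2) := Real.sinh_pos_iff.2 (by linarith)
  have key : ∀ e : GeodesicRay X, e.busemannExp p = e.busemannExp q →
      Real.cosh (L / 2) * e.busemannExp (γ (L / 2)) ^ 2 ≤ e.busemannExp p ^ 2 := by
    intro e he
    have hlim := le_of_tendsto_of_tendsto'
      ((e.tendsto_cosh_point (γ (L / 2))).const_mul (2 * Real.cosh (L / 2)))
      ((e.tendsto_cosh_point p).add (e.tendsto_cosh_point q)) fun t => by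
        have hst := hX.stewart γ L hγ (e.1 t) (L / 2) ⟨by linarith, by linarith⟩
        rw [h0, h1, show L - L / 2 = L / 2 by ring, ← add_mul] at hst
        have e1 : Real.sinh L = 2 * Real.sinh (L / 2) * Real.cosh (L / 2) := by
          rw [← Real.sinh_two_mul]; congr 1; ring
        rw [e1, show ∀ a b c : ℝ, a * (2 * b * c) = (2 * c * a) * b from
          fun a b c => by ring] at hst
        have := mul_le_mul_of_nonneg_right (le_of_mul_le_mul_right hst hs)
          (by positivity : 0 ≤ 2 * Real.exp (-(t : ℝ)))
        rw [dist_comm _ p, dist_comm _ q, dist_comm _ (γ (L / 2))] at this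
        linarith
    rw [he] at hlim ⊢
    linarith
  have kc := key c hcq
  have kd := key d hdq
  have hm := c.horo_le_mul d (γ (L / 2))
  rw [hE] at hm
  have hC : 1 < Real.cosh (L / 2) := Real.one_lt_cosh.2 (by linarith)
  have p1 := c.busemannExp_pos p
  have p2 := d.busemannExp_pos p
  have p3 := c.busemannExp_pos (γ (L / 2))
  have p4 := d.busemannExp_pos (γ (L / 2))
  have h2 : (c.busemannExp p * d.busemannExp p) ^ 2 ≤
      (c.busemannExp (γ (L / 2)) * d.busemannExp (γ (L / 2))) ^ 2 := by gcongr
  have h3 : Real.cosh (L / 2) ^ 2 * (c.busemannExp (γ (L / 2)) * d.busemannExp (γ (L / 2))) ^ 2 ≤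
      (c.busemannExp p * d.busemannExp p) ^ 2 := by
    calc _ = (Real.cosh (L / 2) * c.busemannExp (γ (L / 2)) ^ 2) *
          (Real.cosh (L / 2) * d.busemannExp (γ (L / 2)) ^ 2) := by ring
      _ ≤ c.busemannExp p ^ 2 * d.busemannExp p ^ 2 := by gcongr
      _ = _ := by ring
  have h4 : 0 < (c.busemannExp (γ (L / 2)) * d.busemannExp (γ (L / 2))) ^ 2 := by positivity
  nlinarith [mul_pos (by nlinarith : 0 < Real.cosh (L / 2) ^ 2 - 1) h4]

theorem tendsto_cosh_mul_exp_neg :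
    Tendsto (fun t : ℝ≥0 => 2 * Real.cosh t * Real.exp (-(t : ℝ))) atTop (𝓝 1) := by
  have h := (tendsto_exp_neg_coe.pow 2).const_add 1
  rw [zero_pow two_ne_zero, add_zero] at h
  refine h.congr fun t => ?_
  rw [Real.cosh_eq, mul_div_cancel₀ _ two_ne_zero, add_mul, ← Real.exp_add, add_neg_cancel,
    Real.exp_zero, sq]

theorem GeodesicLine.tendsto_stewart_left (l : GeodesicLine X) (e : GeodesicRay X) :
    Tendsto (fun t : ℝ≥0 => (2 * Real.cosh t * Real.exp (-(t : ℝ))) *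
      (2 * Real.cosh (dist (l.1 0) (e.1 t)) * Real.exp (-(t : ℝ)))) atTop
      (𝓝 (e.busemannExp (l.1 0) ^ 2)) := by
  have := tendsto_cosh_mul_exp_neg.mul (e.tendsto_cosh_point (l.1 0))
  rwa [one_mul] at this

theorem GeodesicLine.stewart_rescale (l : GeodesicLine X) (e : GeodesicRay X) (t : ℝ≥0) :
    (Real.cosh (dist (e.1 t) (l.posRay.1 t)) + Real.cosh (dist (e.1 t) (l.negRay.1 t))) *
      (2 * Real.exp (-(2 * t : ℝ))) =
      2 * Real.cosh (dist (e.1 t) (l.posRay.1 t)) * Real.exp (-(2 * t : ℝ)) +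
      2 * Real.cosh (dist (e.1 t) (l.negRay.1 t)) * Real.exp (-(2 * t : ℝ)) := by ring

/-- Seen from a point of a geodesic line, the squares of the visual distances of a boundary point
to the two endpoints of the line add up to at least `1`. -/
theorem HasStewart.one_le_vis_sq (hX : HasStewart X) (l : GeodesicLine X) (ζ : Boundary X) :
    1 ≤ vis (l.1 0) l.posEnd ζ ^ 2 + vis (l.1 0) l.negEnd ζ ^ 2 := by
  obtain ⟨e, rfl⟩ := exists_endpoint_eq ζ
  have hb := e.busemannExp_pos (l.1 0)
  rw [← l.endpoint_posRay, ← l.endpoint_negRay, hX.vis_endpoint, hX.vis_endpoint,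
    l.busemannExp_posRay, l.busemannExp_negRay, neg_zero, zero_div, Real.exp_zero, one_mul, div_pow,
    div_pow, ← add_div, one_le_div (by positivity), l.posRay.horo_comm, l.negRay.horo_comm]
  refine le_of_tendsto_of_tendsto (l.tendsto_stewart_left e)
    ((e.tendsto_cosh l.posRay).add (e.tendsto_cosh l.negRay))
    ((eventually_gt_atTop 0).mono fun t ht => ?_)
  have ht' : (0 : ℝ) < t := NNReal.coe_pos.2 ht
  have h := hX.stewart (fun s => l.1 (-t + s)) (2 * t)
    (Isometry.isGeodesicSegment l.2 (by positivity) _) (e.1 t) t ⟨ht'.le, by linarith⟩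
  simp only [add_zero, neg_add_cancel] at h
  rw [show -(t : ℝ) + 2 * t = t by ring, show (2 * t - t : ℝ) = t by ring, Real.sinh_two_mul,
    ← add_mul, add_comm (Real.cosh _)] at h
  have h1 := le_of_mul_le_mul_right (h.trans' (le_of_eq (by ring :
    (2 * Real.cosh t * Real.cosh (dist (e.1 t) (l.1 0))) * Real.sinh t = _)))
    (Real.sinh_pos_iff.2 ht')
  have h2 := mul_le_mul_of_nonneg_right h1 (by positivity : 0 ≤ 2 * Real.exp (-(2 * t : ℝ)))
  refine le_trans (le_of_eq ?_) (h2.trans (le_of_eq (l.stewart_rescale e t)))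
  have e2 : Real.exp (-(2 * t : ℝ)) = Real.exp (-(t : ℝ)) ^ 2 := by
    rw [← Real.exp_nat_mul]; congr 1; push_cast; ring
  rw [e2, dist_comm (e.1 t)]
  ring

/-- The exact form of `HasStewart.one_le_vis_sq` in the hyperbolic plane. -/
theorem IsStewartLine.vis_sq {l : GeodesicLine X} (hX : HasStewart X) (hl : IsStewartLine l)
    (ζ : Boundary X) : vis (l.1 0) l.posEnd ζ ^ 2 + vis (l.1 0) l.negEnd ζ ^ 2 = 1 := by
  obtain ⟨e, rfl⟩ := exists_endpoint_eq ζ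
  have hb := e.busemannExp_pos (l.1 0)
  rw [← l.endpoint_posRay, ← l.endpoint_negRay, hX.vis_endpoint, hX.vis_endpoint,
    l.busemannExp_posRay, l.busemannExp_negRay, neg_zero, zero_div, Real.exp_zero, one_mul, div_pow,
    div_pow, ← add_div, div_eq_one_iff_eq (by positivity), l.posRay.horo_comm, l.negRay.horo_comm]
  refine tendsto_nhds_unique ((e.tendsto_cosh l.posRay).add (e.tendsto_cosh l.negRay))
    ((l.tendsto_stewart_left e).congr fun t => ?_)
  rw [← l.stewart_rescale e t]
  obtain ⟨A, B, h⟩ := hl (e.1 t)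
  change _ = (Real.cosh (dist (e.1 t) (l.1 t)) + Real.cosh (dist (e.1 t) (l.1 (-t)))) * _
  have e2 : Real.exp (-(2 * t : ℝ)) = Real.exp (-(t : ℝ)) ^ 2 := by
    rw [← Real.exp_nat_mul]; congr 1; push_cast; ring
  rw [dist_comm, h, h, h, e2, neg_neg, neg_zero, Real.exp_zero, Real.cosh_eq]
  ring

/-- Any two distinct boundary points are the endpoints of a geodesic line. -/
theorem HasStewart.exists_line [ProperSpace X] [Nonempty X] (hX : HasStewart X) {ξ η : Boundary X}
    (h : ξ ≠ η) : ∃ l : GeodesicLine X, l.negEnd = ξ ∧ l.posEnd = η := by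
  obtain ⟨x⟩ := ‹Nonempty X›
  set c := hX.ray x ξ with hc
  set d := hX.ray x η with hd
  have hc0 : c.1 0 = x := hX.ray_zero _ _
  have hd0 : d.1 0 = x := hX.ray_zero _ _
  set E := c.horo d with hE
  have hE0 : 0 < E := by
    rw [hE, hc, hd, ← hX.vis_eq_horo]; exact hX.vis_pos x h
  have hseg : ∀ n : ℕ, ∃ (L : ℝ) (μ : ℝ → X), L = dist (c.1 n) (d.1 n) ∧ IsGeodesicSegment μ L ∧
      μ 0 = c.1 n ∧ μ L = d.1 n := fun n => ⟨_, (hX.exists_segment _ _).imp fun μ h => ⟨rfl, h⟩⟩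
  choose L μ hL hμ hμ0 hμ1 using hseg
  have hL0 : ∀ n, 0 ≤ L n := fun n => (hμ n).1
  have hLE : ∀ n : ℕ, Real.exp (-(L n / 2)) ≤ Real.exp (-(n : ℝ)) / E := fun n => by
    have h1 := c.horo_le d n n
    rw [le_div_iff₀ hE0]
    calc Real.exp (-(L n / 2)) * E ≤ Real.exp (-(L n / 2)) *
          Real.exp ((dist (c.1 n) (d.1 n) - n - n) / 2) := by
          gcongr; simpa using h1
      _ = _ := by rw [← Real.exp_add]; congr 1; rw [hL]; ring
  have hLn : ∀ n : ℕ, (n : ℝ) + Real.log E ≤ L n / 2 := fun n => by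
    have h1 := hLE n
    rw [le_div_iff₀ hE0] at h1
    nth_rewrite 1 [← Real.exp_log hE0] at h1
    rw [← Real.exp_add, Real.exp_le_exp] at h1
    linarith
  have hmid : ∀ n : ℕ, dist x (μ n (L n / 2)) ≤ Real.log (4 / E) := fun n => by
    have := hL0 n
    rw [Real.le_log_iff_exp_le (by positivity)]
    have h1 := hX.exp_dist_le (hμ n) (t := L n / 2) ⟨by positivity, by linarith⟩ x
    have h2 : dist x (c.1 n) = n := by rw [← hc0, c.dist_zero]; simp
    have h3 : dist x (d.1 n) = n := by rw [← hd0, d.dist_zero]; simp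
    rw [hμ0, hμ1, h2, h3, sub_half] at h1
    have h4 : Real.exp (n : ℝ) * Real.exp (-(n : ℝ)) = 1 := by
      rw [← Real.exp_add, add_neg_cancel, Real.exp_zero]
    have h5 : Real.exp (-(n : ℝ)) ≤ 1 := Real.exp_le_one_iff.2 (by simp)
    calc Real.exp (dist x (μ n (L n / 2))) ≤ 2 * (Real.exp n + 1) * Real.exp (-(L n / 2)) := by
          linarith
      _ ≤ 2 * (Real.exp n + 1) * (Real.exp (-(n : ℝ)) / E) := by gcongr; exact hLE n
      _ = 2 * (Real.exp n * Real.exp (-(n : ℝ)) + Real.exp (-(n : ℝ))) / E := by ring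
      _ ≤ 4 / E := by gcongr; linarith
  have hev : ∀ t : ℝ, ∀ᶠ n : ℕ in hyperfilter ℕ, |t| ≤ L n / 2 := fun t =>
    (eventually_le_natCast (|t| - Real.log E)).mono fun n hn => by linarith [hLn n]
  have hmem : ∀ {n : ℕ} {t : ℝ}, |t| ≤ L n / 2 → L n / 2 + t ∈ Set.Icc 0 (L n) := fun {n t} ht =>
    ⟨by linarith [neg_abs_le t], by linarith [le_abs_self t]⟩
  have hdist : ∀ {n : ℕ} {s t : ℝ}, |s| ≤ L n / 2 → |t| ≤ L n / 2 →
      dist (μ n (L n / 2 + s)) (μ n (L n / 2 + t)) = |s - t| := fun hs ht => by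
    rw [(hμ _).2 _ (hmem hs) _ (hmem ht), add_sub_add_left_eq_sub]
  obtain ⟨l, hl, hlim⟩ := exists_limit_isometry (hyperfilter ℕ) (fun n t => μ n (L n / 2 + t)) x
    (fun t => ⟨|t| + Real.log (4 / E), (hev t).mono fun n hn => by
      have h0 : |(0 : ℝ)| ≤ L n / 2 := by rw [abs_zero]; exact (abs_nonneg t).trans hn
      have h1 := hdist hn h0
      have h2 := dist_triangle (μ n (L n / 2 + t)) (μ n (L n / 2 + 0)) x
      rw [h1, sub_zero, add_zero, dist_comm (μ n (L n / 2)) x] at h2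
      linarith [hmid n]⟩)
    (fun s t => ((hev s).and (hev t)).mono fun n hn => hdist hn.1 hn.2)
  refine ⟨⟨⟨l, hl.continuous⟩, hl⟩, ?_, ?_⟩
  · rw [← hX.endpoint_ray x ξ, ← hc]
    refine endpoint_eq_iff.2 ⟨3 * Real.log (4 / E), fun t => ?_⟩
    change dist (l (-t)) (c.1 t) ≤ _
    refine le_of_tendsto ((hlim (-t)).dist tendsto_const_nhds) ?_
    filter_upwards [hev t, eventually_le_natCast t] with n hn hn'
    rw [NNReal.abs_eq] at hn
    have hLn0 := hL0 n
    have hseg : IsGeodesicSegment (fun s => μ n (L n / 2 - s)) (L n / 2) := by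
      refine ⟨by positivity, fun s hs t ht => ?_⟩
      rw [(hμ n).2 _ ⟨by linarith [hs.2], by linarith [hs.1]⟩ _
        ⟨by linarith [ht.2], by linarith [ht.1]⟩, sub_sub_sub_cancel_left, abs_sub_comm]
    have h := hX.fellow_travel hseg (c.isGeodesicSegment (Nat.cast_nonneg n)) (t := t)
      (by rw [Real.toNNReal_natCast, sub_self, hμ0]) ⟨t.2, hn⟩ ⟨t.2, hn'⟩
    simp only [sub_zero, Real.toNNReal_zero, hc0, Real.toNNReal_coe] at h
    rw [dist_comm _ x] at h
    exact h.trans (by linarith [hmid n])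
  · rw [← hX.endpoint_ray x η, ← hd]
    refine endpoint_eq_iff.2 ⟨3 * Real.log (4 / E), fun t => ?_⟩
    change dist (l t) (d.1 t) ≤ _
    refine le_of_tendsto ((hlim t).dist tendsto_const_nhds) ?_
    filter_upwards [hev t, eventually_le_natCast t] with n hn hn'
    rw [NNReal.abs_eq] at hn
    have hLn0 := hL0 n
    have h := hX.fellow_travel ((hμ n).sub (b := L n / 2) (l := L n / 2) (by positivity)
      (by positivity) (by linarith)) (d.isGeodesicSegment (Nat.cast_nonneg n))
      (t := t) (by rw [Real.toNNReal_natCast, add_halves, hμ1]) ⟨t.2, hn⟩ ⟨t.2, hn'⟩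
    simp only [add_zero, Real.toNNReal_zero, hd0, Real.toNNReal_coe] at h
    rw [dist_comm _ x] at h
    exact h.trans (by linarith [hmid n])

end Lines

/-! ### Moebius maps -/

section Moebius

/-- A map which preserves cross ratios is conformal. -/
theorem exists_conformal_factor {A B : Type*} {v : A → A → ℝ} {V : B → B → ℝ}
    (hv : ∀ ξ η, ξ ≠ η → 0 < v ξ η) (hv0 : ∀ ξ, v ξ ξ = 0) (hvs : ∀ ξ η, v ξ η = v η ξ)
    (hV : ∀ ξ η, ξ ≠ η → 0 < V ξ η) (hV0 : ∀ ξ, V ξ ξ = 0) (hVs : ∀ ξ η, V ξ η = V η ξ)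
    {f : A → B} (hf : Function.Injective f) {a b c : A} (hab : a ≠ b) (hac : a ≠ c) (hbc : b ≠ c)
    (h : ∀ ξ₀ η₀ ξ₁ η₁, Distinct4 ξ₀ η₀ ξ₁ η₁ →
      V (f ξ₀) (f ξ₁) * V (f η₀) (f η₁) * (v ξ₀ η₁ * v ξ₁ η₀) =
        v ξ₀ ξ₁ * v η₀ η₁ * (V (f ξ₀) (f η₁) * V (f ξ₁) (f η₀))) :
    ∃ j : A → ℝ, (∀ ξ, 0 < j ξ) ∧ ∀ ξ η, V (f ξ) (f η) = j ξ * j η * v ξ η := by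
  classical
  set r : A → A → ℝ := fun ξ η => V (f ξ) (f η) / v ξ η with hr
  have hr0 : ∀ ξ η, ξ ≠ η → 0 < r ξ η := fun ξ η hne => div_pos (hV _ _ (hf.ne hne)) (hv _ _ hne)
  have hrs : ∀ ξ η, r ξ η = r η ξ := fun ξ η => by simp only [hr]; rw [hVs, hvs]
  have key : ∀ ξ η ζ, ξ ≠ a → η ≠ a → ζ ≠ a → η ≠ ξ → ζ ≠ ξ →
      r η a * r ξ ζ = r ζ a * r ξ η := by
    intro ξ η ζ hξ hη hζ hηξ hζξ
    rcases eq_or_ne η ζ with rfl | hηζ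
    · rfl
    have := h η ζ a ξ ⟨hηζ, hη, hηξ, hζ, hζξ, hξ.symm⟩
    rw [hrs ξ ζ, hrs ζ a, hrs ξ η]
    simp only [hr]
    have h1 := hv _ _ hη
    have h2 := hv _ _ hζξ
    have h3 := hv _ _ hηξ
    have h4 := hv _ _ hζ.symm
    rw [div_mul_div_comm, div_mul_div_comm, div_eq_div_iff (by positivity) (by positivity)]
    linear_combination this
  have claim : ∀ ξ η, ξ ≠ a → η ≠ a → ξ ≠ η →
      r ξ a * r η a * r b c = r a b * r a c * r ξ η := by
    intro ξ η hξ hη hne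
    rcases eq_or_ne ξ c with rfl | hξc
    · have := key ξ η b hξ hη hab.symm hne.symm hbc
      rw [hrs a b, hrs a ξ, hrs b ξ]
      linear_combination r ξ a * this
    · have h1 := key ξ η c hξ hη hac.symm hne.symm hξc.symm
      have h2 := key c ξ b hac.symm hξ hab.symm hξc hbc
      rw [hrs a b, hrs a c, hrs b c]
      rw [hrs c ξ] at h2
      linear_combination r η a * h2 + r b a * h1
  set S := r a b * r a c / r b c with hS
  have hS0 : 0 < S := div_pos (mul_pos (hr0 _ _ hab) (hr0 _ _ hac)) (hr0 _ _ hbc)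
  have hSq : √S * √S = S := Real.mul_self_sqrt hS0.le
  have hsS : 0 < √S := Real.sqrt_pos.2 hS0
  have hV' : ∀ ξ η, ξ ≠ η → V (f ξ) (f η) = r ξ η * v ξ η := fun ξ η hne =>
    (div_mul_cancel₀ _ (hv _ _ hne).ne').symm
  refine ⟨fun ξ => if ξ = a then √S else r ξ a / √S, fun ξ => ?_, fun ξ η => ?_⟩
  · dsimp only
    split_ifs with h1
    · exact hsS
    · exact div_pos (hr0 _ _ h1) hsS
  · rcases eq_or_ne ξ η with rfl | hne
    · rw [hV0, hv0, mul_zero]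
    rw [hV' _ _ hne]
    congr 1
    dsimp only
    split_ifs with h1 h2 h2
    · exact absurd (h1.trans h2.symm) hne
    · rw [h1, mul_div_cancel₀ _ hsS.ne', hrs]
    · rw [h2, div_mul_cancel₀ _ hsS.ne']
    · rw [div_mul_div_comm, hSq, hS, eq_div_iff hS0.ne', mul_div_assoc']
      rw [div_eq_iff (hr0 _ _ hbc).ne']
      linear_combination -claim ξ η h1 h2 hne

theorem abs_deriv_sub_le_of_le {G H : ℝ → ℝ} {a b t₀ δ : ℝ} (hG : HasDerivAt G a t₀)
    (hH : HasDerivAt H b t₀) (h0 : G t₀ = H t₀) (h : ∀ t, G t ≤ H t + δ * |t - t₀|) :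
    |a - b| ≤ δ := by
  have hD := (hG.sub hH)
  rw [hasDerivAt_iff_tendsto_slope] at hD
  have hs : ∀ t, slope (G - H) t₀ t = (G t - H t) / (t - t₀) := fun t => by
    simp only [slope, vsub_eq_sub, Pi.sub_apply, smul_eq_mul, h0, sub_self, sub_zero]
    rw [div_eq_inv_mul]
  rw [abs_le]
  constructor
  · refine ge_of_tendsto (hD.mono_left (nhdsLT_le_nhdsNE t₀)) ?_
    filter_upwards [self_mem_nhdsWithin] with t ht
    have ht' : t - t₀ < 0 := sub_neg.2 ht
    have := h t
    rw [abs_of_neg ht'] at this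
    rw [hs, le_div_iff_of_neg ht']
    linarith
  · refine le_of_tendsto (hD.mono_left (nhdsGT_le_nhdsNE t₀)) ?_
    filter_upwards [self_mem_nhdsWithin] with t ht
    have ht' : 0 < t - t₀ := sub_pos.2 ht
    have := h t
    rw [abs_of_pos ht'] at this
    rw [hs, div_le_iff₀ ht']
    linarith

/-- Let `γ` be a circle through `n∞` in a separable Ptolemaic metric space `(B, V)`. Then there is a
point `n = γ t₀` such that no two different points `m₁` and `m₂` of `γ` divide the same pair
`P`, `Q` in the same ratio with respect to `n`, i.e. satisfy equality in the Ptolemy inequality for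
`P`, `m`, `Q`, `n` with equal cross ratios.

Indeed, the functions `t ↦ V(z, γ t)`, suitably normalised, are Lipschitz. Hence there is a `t₀` at
which they are differentiable for all `z` in a countable dense set. For `y` on the circle close to
`n`, the Ptolemy inequality bounds `V(y, m₁)` and `V(y, m₂)` by the same (almost) differentiable
function, with equality for `y = n`. So the logarithmic derivatives at `n` of `V(·, m₁)` and
`V(·, m₂)` along the circle coincide, and they determine the position on the circle. -/
theorem exists_regular_point {B : Type*} {V : B → B → ℝ} (hV : ∀ ξ η, ξ ≠ η → 0 < V ξ η)
    (hV0 : ∀ ξ η, 0 ≤ V ξ η) (hVs : ∀ ξ η, V ξ η = V η ξ) (htri : ∀ a b c, V a c ≤ V a b + V b c)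
    (hP : ∀ a b c d, V a c * V b d ≤ V a b * V c d + V b c * V a d)
    {Z : Set B} (hZ : Z.Countable) (hZd : ∀ ξ, ∀ δ > 0, ∃ z ∈ Z, V ξ z < δ)
    {γ : ℝ → B} {w : ℝ → ℝ} (hw : ∀ t, 0 < w t) (hγ : ∀ s t, V (γ s) (γ t) = w s * w t * |s - t|)
    {ninf : B} {winf : ℝ} (hwinf : 0 < winf) (hinf : ∀ t, V ninf (γ t) = winf * w t) :
    ∃ t₀, ∀ (P Q : B) (t₁ t₂ θ : ℝ), t₁ ≠ t₀ → t₂ ≠ t₀ → P ≠ γ t₀ → Q ≠ γ t₀ → P ≠ Q →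
      (∀ t ∈ ({t₁, t₂} : Set ℝ),
        V P (γ t) * V Q (γ t₀) = θ * (V P Q * V (γ t) (γ t₀)) ∧
        V Q (γ t) * V P (γ t₀) = (1 - θ) * (V P Q * V (γ t) (γ t₀))) → t₁ = t₂ := by
  set h : B → ℝ → ℝ := fun z t => V z (γ t) / w t with hh
  have hlip : ∀ z s t, h z s ≤ V z ninf / winf * |s - t| + h z t := fun z s t => by
    have hws := hw s
    have hwt := hw t
    have h1 := hP z ninf (γ s) (γ t)
    rw [hγ, hinf, hinf] at h1
    have h2 : h z s = V z (γ s) * (winf * w t) / (winf * w s * w t) := by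
      simp only [hh]; field_simp
    have h3 : V z ninf / winf * |s - t| + h z t =
        (V z ninf * (w s * w t * |s - t|) + winf * w s * V z (γ t)) / (winf * w s * w t) := by
      simp only [hh]; field_simp
    rw [h2, h3]
    gcongr
  have hdiff : ∀ z, ∀ᵐ t, DifferentiableAt ℝ (h z) t := fun z => by
    have hC : 0 ≤ V z ninf / winf := div_nonneg (hV0 _ _) hwinf.le
    refine LipschitzWith.ae_differentiableAt_real (C := ⟨_, hC⟩)
      (LipschitzWith.of_dist_le_mul fun s t => ?_)
    rw [Real.dist_eq, Real.dist_eq, abs_sub_le_iff]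
    have h1 := hlip z s t
    have h2 := hlip z t s
    rw [abs_sub_comm t s] at h2
    exact ⟨by change _ ≤ V z ninf / winf * _; linarith, by change _ ≤ V z ninf / winf * _; linarith⟩
  obtain ⟨t₀, ht₀⟩ := ((MeasureTheory.ae_ball_iff hZ).2 fun z _ => hdiff z).exists
  refine ⟨t₀, fun P Q t₁ t₂ θ h1 h2 hPn hQn hPQ hm => ?_⟩
  have hw0 := hw t₀
  set n := γ t₀ with hn
  -- approximation of the normalised distance functions by differentiable ones
  have happrox : ∀ z, z ≠ n → ∀ δ > 0, ∃ q : ℝ → ℝ, DifferentiableAt ℝ q t₀ ∧ q t₀ = 1 ∧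
      ∀ t, h z t / h z t₀ ≤ q t + δ * |t - t₀| := by
    intro z hz δ hδ
    have hzn := hV _ _ hz
    obtain ⟨z', hz'Z, hz'⟩ := hZd z (min (V z n / 2) (δ * V z n ^ 2 / (2 * w t₀ ^ 2)))
      (lt_min (by positivity) (by positivity))
    have h3 := hz'.trans_le (min_le_left _ _)
    have h4 := hz'.trans_le (min_le_right _ _)
    have h5 := htri z z' n
    have hz'n : V z n / 2 ≤ V z' n := by linarith
    have hz'n0 : 0 < V z' n := by linarith
    have hz0 : 0 < h z t₀ := div_pos hzn hw0
    have hz'0 : 0 < h z' t₀ := div_pos hz'n0 hw0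
    refine ⟨fun t => h z' t / h z' t₀, (ht₀ z' hz'Z).div_const _, div_self hz'0.ne', fun t => ?_⟩
    have hwt := hw t
    have h6 := hP z z' (γ t) n
    rw [hγ] at h6
    have h7 : h z t * h z' t₀ ≤ V z z' * |t - t₀| + h z' t * h z t₀ := by
      have e1 : h z t * h z' t₀ = V z (γ t) * V z' n / (w t * w t₀) := by
        simp only [hh]; rw [div_mul_div_comm]
      have e2 : V z z' * |t - t₀| + h z' t * h z t₀ =
          (V z z' * (w t * w t₀ * |t - t₀|) + V z' (γ t) * V z n) / (w t * w t₀) := by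
        simp only [hh]; field_simp; rfl
      rw [e1, e2]
      gcongr
    have h8 : V z z' ≤ δ * (h z t₀ * h z' t₀) := by
      calc V z z' ≤ δ * (V z n * (V z n / 2)) / (w t₀ ^ 2) := by
            refine h4.le.trans (le_of_eq ?_); field_simp
        _ ≤ δ * (V z n * V z' n) / (w t₀ ^ 2) := by gcongr
        _ = δ * (h z t₀ * h z' t₀) := by simp only [hh]; field_simp; rfl
    have h9 : V z z' * |t - t₀| ≤ δ * (h z t₀ * h z' t₀) * |t - t₀| := by gcongr
    rw [div_le_iff₀ hz0, add_mul, div_mul_eq_mul_div, ← sub_le_iff_le_add, le_div_iff₀ hz'0]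
    linarith
  have hPQ0 := hV _ _ hPQ
  have hPn0 := hV _ _ hPn
  have hQn0 := hV _ _ hQn
  -- bound of `V(y, m)` for points `y` of the circle
  have hbound : ∀ t ∈ ({t₁, t₂} : Set ℝ), ∀ s, |s - t| / |t₀ - t| ≤
      (1 - θ) * (h P s / h P t₀) + θ * (h Q s / h Q t₀) := by
    intro t ht s
    have htne : t₀ - t ≠ 0 := by
      rcases ht with rfl | rfl
      · exact sub_ne_zero.2 h1.symm
      · exact sub_ne_zero.2 h2.symm
    have habs : 0 < |t₀ - t| := abs_pos.2 htne
    have hwt := hw t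
    have hws := hw s
    obtain ⟨m1, m2⟩ := hm t ht
    have hpt := hP P (γ s) Q (γ t)
    rw [hVs (γ s) Q] at hpt
    rw [hn, hγ t t₀, abs_sub_comm, ← hn] at m1 m2
    rw [hγ s t] at hpt
    have e1 : (1 - θ) * (h P s / h P t₀) + θ * (h Q s / h Q t₀) =
        (V P (γ s) * ((1 - θ) * (V P Q * (w t * w t₀ * |t₀ - t|))) / V P n +
          V Q (γ s) * (θ * (V P Q * (w t * w t₀ * |t₀ - t|))) / V Q n) /
          (V P Q * (w s * w t * |t₀ - t|)) := by
      simp only [hh]; rw [← hn]; field_simp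
    have e2 : |s - t| / |t₀ - t| = V P Q * (w s * w t * |s - t|) /
        (V P Q * (w s * w t * |t₀ - t|)) := by field_simp
    rw [e1, e2, ← m1, ← m2]
    have e3 : V P (γ s) * (V Q (γ t) * V P n) / V P n = V P (γ s) * V Q (γ t) := by field_simp
    have e4 : V Q (γ s) * (V P (γ t) * V Q n) / V Q n = V Q (γ s) * V P (γ t) := by field_simp
    rw [e3, e4]
    gcongr
  have hθ : 0 ≤ θ ∧ 0 ≤ 1 - θ := by
    obtain ⟨m1, m2⟩ := hm t₁ (Or.inl rfl)
    have hne : 0 < V (γ t₁) n := by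
      rw [hn, hγ]
      have := abs_pos.2 (sub_ne_zero.2 h1)
      have := hw t₁
      positivity
    have hp : 0 < V P Q * V (γ t₁) n := mul_pos hPQ0 hne
    exact ⟨nonneg_of_mul_nonneg_left (m1 ▸ mul_nonneg (hV0 _ _) (hV0 _ _)) hp,
      nonneg_of_mul_nonneg_left (m2 ▸ mul_nonneg (hV0 _ _) (hV0 _ _)) hp⟩
  have hderiv : ∀ t, t ≠ t₀ → HasDerivAt (fun s => |s - t| / |t₀ - t|) (1 / (t₀ - t)) t₀ := by
    intro t ht
    have hne : t₀ - t ≠ 0 := sub_ne_zero.2 ht.symm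
    have hd : HasDerivAt (fun s => (s - t) / (t₀ - t)) (1 / (t₀ - t)) t₀ :=
      ((hasDerivAt_id t₀).sub_const t).div_const _
    refine hd.congr_of_eventuallyEq ?_
    rcases hne.lt_or_gt with hlt | hlt
    · filter_upwards [gt_mem_nhds (sub_neg.1 hlt)] with s hs
      rw [abs_of_neg hlt, abs_of_neg (sub_neg.2 hs), neg_div_neg_eq]
    · filter_upwards [lt_mem_nhds (sub_pos.1 hlt)] with s hs
      rw [abs_of_pos hlt, abs_of_pos (sub_pos.2 hs)]
  have hfin : ∀ δ > 0, |1 / (t₀ - t₁) - 1 / (t₀ - t₂)| ≤ 2 * δ := by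
    intro δ hδ
    obtain ⟨qP, dP, eP, bP⟩ := happrox P hPn δ hδ
    obtain ⟨qQ, dQ, eQ, bQ⟩ := happrox Q hQn δ hδ
    have hd := (dP.hasDerivAt.const_mul (1 - θ)).add (dQ.hasDerivAt.const_mul θ)
    have main : ∀ t ∈ ({t₁, t₂} : Set ℝ), t ≠ t₀ →
        |1 / (t₀ - t) - ((1 - θ) * deriv qP t₀ + θ * deriv qQ t₀)| ≤ δ := by
      intro t ht hne
      refine abs_deriv_sub_le_of_le (hderiv t hne) hd ?_ fun s => ?_
      · simp only [Pi.add_apply, eP, eQ]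
        rw [div_self (abs_pos.2 (sub_ne_zero.2 hne.symm)).ne']; ring
      · refine (hbound t ht s).trans ?_
        simp only [Pi.add_apply]
        nlinarith [mul_le_mul_of_nonneg_left (bP s) hθ.2, mul_le_mul_of_nonneg_left (bQ s) hθ.1]
    have m1 := main t₁ (Or.inl rfl) h1
    have m2 := main t₂ (Or.inr rfl) h2
    rw [abs_le] at m1 m2 ⊢
    constructor <;> linarith
  have hz : |1 / (t₀ - t₁) - 1 / (t₀ - t₂)| ≤ 0 :=
    le_of_forall_pos_le_add fun ε hε => by linarith [hfin (ε / 2) (by positivity)]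
  have h3 := sub_eq_zero.1 (abs_nonpos_iff.1 hz)
  have h4 := (inv_injective (by simpa only [one_div] using h3) : t₀ - t₁ = t₀ - t₂)
  linarith

end Moebius

/-! ### The boundary of the hyperbolic plane -/

section PlaneBoundary

theorem vis_bdReal (o : ℍ) : ∃ (k : ℝ → ℝ) (kinf : ℝ), (∀ s, 0 < k s) ∧ 0 < kinf ∧
    (∀ s t, vis o (bdReal s) (bdReal t) = k s * k t * |s - t|) ∧
    ∀ t, vis o bdInfty (bdReal t) = kinf * k t := by
  refine ⟨fun s => 1 / (downRay s).busemannExp o, 1 / upRay.busemannExp o, fun s =>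
    one_div_pos.2 (GeodesicRay.busemannExp_pos _ _),
    one_div_pos.2 (GeodesicRay.busemannExp_pos _ _),
    fun s t => ?_, fun t => ?_⟩
  · have := hasStewart_upperHalfPlane.vis_endpoint o (downRay s) (downRay t)
    rw [horo_downRay] at this
    refine this.trans ?_
    rw [one_div_mul_one_div, one_div_mul_eq_div]
  · have := hasStewart_upperHalfPlane.vis_endpoint o upRay (downRay t)
    rw [horo_upRay] at this
    refine this.trans ?_
    rw [one_div_mul_one_div]

theorem bdReal_injective : Function.Injective bdReal := by
  intro s t h
  obtain ⟨k, -, hk, -, hst, -⟩ := vis_bdReal UpperHalfPlane.I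
  have := hst s t
  rw [h, vis_self] at this
  have h0 := (mul_eq_zero.1 this.symm).resolve_left (mul_pos (hk s) (hk t)).ne'
  exact sub_eq_zero.1 (abs_eq_zero.1 h0)

theorem bdInfty_ne_bdReal (t : ℝ) : bdInfty ≠ bdReal t := by
  intro h
  obtain ⟨k, kinf, hk, hkinf, -, hi⟩ := vis_bdReal UpperHalfPlane.I
  have := hi t
  rw [h, vis_self] at this
  exact (mul_pos hkinf (hk t)).ne this

/-- For every point `m` of the boundary circle of the hyperbolic plane different from `∞`, `0` and
`1`, these three points can be labelled as `P`, `Q`, `N` such that `m` separates `P` from `Q` on the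
complement of `N`, whence equality in the Ptolemy inequality. -/
theorem exists_ptolemy_eq (o : ℍ) {m : Boundary ℍ} (h : m ≠ bdInfty) (h0 : m ≠ bdReal 0)
    (h1 : m ≠ bdReal 1) : ∃ P Q N : Boundary ℍ, P ≠ Q ∧ P ≠ N ∧ Q ≠ N ∧ m ≠ N ∧
      (∀ ζ ∈ ({P, Q, N} : Set (Boundary ℍ)), ζ = bdInfty ∨ ζ = bdReal 0 ∨ ζ = bdReal 1) ∧
      ∃ θ : ℝ, vis o P m * vis o Q N = θ * (vis o P Q * vis o m N) ∧
        vis o Q m * vis o P N = (1 - θ) * (vis o P Q * vis o m N) := by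
  obtain ⟨s, rfl⟩ := (boundary_cases m).resolve_left h
  have hs0 : s ≠ 0 := fun e => h0 (by rw [e])
  have hs1 : s ≠ 1 := fun e => h1 (by rw [e])
  have h01 : bdReal 0 ≠ bdReal 1 := fun e => zero_ne_one (bdReal_injective e)
  obtain ⟨k, kinf, hk, hkinf, hst, hi⟩ := vis_bdReal o
  have hi' : ∀ t, vis o (bdReal t) bdInfty = kinf * k t := fun t => by rw [vis_comm, hi]
  rcases hs0.lt_or_gt with hlt | hgt
  · refine ⟨bdReal 0, bdInfty, bdReal 1, (bdInfty_ne_bdReal 0).symm, h01, bdInfty_ne_bdReal 1, h1,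
      by rintro ζ (rfl | rfl | rfl) <;> simp, -s / (1 - s), ?_, ?_⟩
    · rw [hst, hi, hi', hst, zero_sub, abs_neg, abs_of_neg hlt, abs_of_neg (by linarith)]
      field_simp [(by linarith : 1 - s ≠ 0)]
      ring
    · rw [hst, hi, hi', hst, zero_sub, abs_neg, abs_one, abs_of_neg (by linarith : s - 1 < 0)]
      have : 1 - s ≠ 0 := by linarith
      field_simp
      ring
  rcases hs1.lt_or_gt with hlt1 | hgt1
  · refine ⟨bdReal 0, bdReal 1, bdInfty, h01, (bdInfty_ne_bdReal 0).symm,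
      (bdInfty_ne_bdReal 1).symm,
      h, by rintro ζ (rfl | rfl | rfl) <;> simp, s, ?_, ?_⟩
    · rw [hst, hi', hst, hi', zero_sub, zero_sub, abs_neg, abs_neg, abs_one, abs_of_pos hgt]
      ring
    · rw [hst, hi', hst, hi', zero_sub, abs_neg, abs_one, abs_of_pos (sub_pos.2 hlt1)]
      ring
  · refine ⟨bdReal 1, bdInfty, bdReal 0, (bdInfty_ne_bdReal 1).symm, h01.symm, bdInfty_ne_bdReal 0,
      h0, by rintro ζ (rfl | rfl | rfl) <;> simp, (s - 1) / s, ?_, ?_⟩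
    · rw [hst, hi, hi', hst, sub_zero, abs_of_pos hgt, abs_of_neg (by linarith)]
      field_simp
      ring
    · rw [hst, hi, hi', hst, sub_zero, sub_zero, abs_one, abs_of_pos hgt]
      field_simp
      ring

/-- Every boundary point of the hyperbolic plane has an antipode with respect to any point. -/
theorem exists_antipode (p : ℍ) (η : Boundary ℍ) : ∃ η', vis p η η' = 1 := by
  have hH := hasStewart_upperHalfPlane
  obtain ⟨l, hl, -⟩ := (hH.ray p η).exists_line
  have h0 : l.1 0 = p := by simpa [hH.ray_zero] using hl 0
  have h1 : l.posEnd = η := by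
    rw [← hH.endpoint_ray p η]
    refine endpoint_eq_iff.2 ⟨0, fun t => ?_⟩
    change dist (l.1 t) _ ≤ 0
    rw [hl, dist_self]
  exact ⟨l.negEnd, by rw [← h0, ← h1, hH.vis_line]⟩

end PlaneBoundary

/-! ### Moebius embeddings of the boundary of the hyperbolic plane -/

section Embedding

variable {X : Type*} [MetricSpace X]

/-- Moebius embeddings of the boundary of the hyperbolic plane, in the sense of conformal maps
between visual metrics. -/
def IsMoebius (o : ℍ) (x : X) (f : Boundary ℍ → Boundary X) : Prop :=
  ∃ j : Boundary ℍ → ℝ, (∀ ξ, 0 < j ξ) ∧ ∀ ξ η, vis x (f ξ) (f η) = j ξ * j η * vis o ξ η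

theorem IsMoebius.ne {o : ℍ} {x : X} {f : Boundary ℍ → Boundary X} (hf : IsMoebius o x f)
    {ξ η : Boundary ℍ} (h : ξ ≠ η) : f ξ ≠ f η := by
  obtain ⟨j, hj, hfj⟩ := hf
  intro e
  have h1 := hfj ξ η
  rw [e, vis_self] at h1
  have := hj ξ
  have := hj η
  have := hasStewart_upperHalfPlane.vis_pos o h
  have : 0 < j ξ * j η * vis o ξ η := by positivity
  linarith

theorem IsMoebius.basepoint {o : ℍ} {x : X} {f : Boundary ℍ → Boundary X} (hf : IsMoebius o x f)
    (p : ℍ) (q : X) : IsMoebius p q f := by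
  obtain ⟨j, hj, hfj⟩ := hf
  refine ⟨fun ξ => conf x q (f ξ) * j ξ * conf p o ξ, fun ξ =>
    mul_pos (mul_pos (conf_pos _ _ _) (hj ξ)) (conf_pos _ _ _), fun ξ η => ?_⟩
  rw [vis_conf x q, hfj, vis_conf p o]
  ring

theorem HasStewart.vis_triangle [ProperSpace X] (hX : HasStewart X) (p : X) (a b c : Boundary X) :
    vis p a c ≤ vis p a b + vis p b c := by
  have h := hX.horo_triangle (hX.ray p a) (hX.ray p b) (hX.ray p c) p
  have e : ∀ ξ, (hX.ray p ξ).busemannExp p = 1 := fun ξ => by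
    have := (hX.ray p ξ).busemannExp_zero
    rwa [hX.ray_zero] at this
  simpa only [e, mul_one, ← hX.vis_eq_horo] using h

theorem Boundary.map_map_symm (g : X ≃ᵢ X) (ξ : Boundary X) :
    Boundary.map g (Boundary.map g.symm ξ) = ξ := by
  obtain ⟨c, rfl⟩ := exists_endpoint_eq ξ
  rw [GeodesicRay.endpoint_map, GeodesicRay.endpoint_map]
  congr 1
  exact Subtype.ext (ContinuousMap.ext fun t => g.apply_symm_apply _)

/-- A Moebius embedding of the boundary circle of the hyperbolic plane is determined by the images
of three points: otherwise, by transitivity on triples, no point of its image would be regular in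
the sense of `exists_regular_point`. -/
theorem IsMoebius.eq [ProperSpace X] (hX : HasStewart X) (htrans : TransitiveOnTriples X) {o : ℍ}
    {x : X} {f₁ f₂ : Boundary ℍ → Boundary X} (h₁ : IsMoebius o x f₁) (h₂ : IsMoebius o x f₂)
    (hi : f₁ bdInfty = f₂ bdInfty) (h0 : f₁ (bdReal 0) = f₂ (bdReal 0))
    (h1 : f₁ (bdReal 1) = f₂ (bdReal 1)) : f₁ = f₂ := by
  funext m
  by_cases hmi : m = bdInfty
  · rw [hmi, hi]
  by_cases hm0 : m = bdReal 0
  · rw [hm0, h0]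
  by_cases hm1 : m = bdReal 1
  · rw [hm1, h1]
  by_contra hne
  obtain ⟨P, Q, N, hPQ, hPN, hQN, hmN, hmem, θ, e1, e2⟩ := exists_ptolemy_eq o hmi hm0 hm1
  have hagree : ∀ ζ ∈ ({P, Q, N} : Set (Boundary ℍ)), f₁ ζ = f₂ ζ := fun ζ hζ => by
    rcases hmem ζ hζ with rfl | rfl | rfl <;> assumption
  have aP := hagree P (by simp)
  have aQ := hagree Q (by simp)
  have aN := hagree N (by simp)
  -- the images of `m` under both maps divide the pair `f P`, `f Q` in the same ratio
  have hrel : ∀ f : Boundary ℍ → Boundary X, IsMoebius o x f →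
      vis x (f P) (f m) * vis x (f Q) (f N) = θ * (vis x (f P) (f Q) * vis x (f m) (f N)) ∧
      vis x (f Q) (f m) * vis x (f P) (f N) =
        (1 - θ) * (vis x (f P) (f Q) * vis x (f m) (f N)) := by
    rintro f ⟨j, hj, hfj⟩
    simp only [hfj]
    exact ⟨by linear_combination (j P * j m * j Q * j N) * e1,
      by linear_combination (j P * j m * j Q * j N) * e2⟩
  have r1 := hrel f₁ h₁
  have r2 := hrel f₂ h₂
  rw [← aP, ← aQ, ← aN] at r2
  obtain ⟨j, hj, hfj⟩ := id h₁
  obtain ⟨k, kinf, hk, hkinf, hst, hinf⟩ := vis_bdReal o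
  obtain ⟨Z, hZ, hZd⟩ := hX.exists_countable_vis_dense x
  obtain ⟨t₀, hreg⟩ := exists_regular_point (V := vis x) (fun ξ η h => hX.vis_pos x h)
    (vis_nonneg x)
    (vis_comm x) (hX.vis_triangle x) (hX.vis_ptolemy x) hZ hZd (γ := fun t => f₁ (bdReal t))
    (w := fun t => j (bdReal t) * k t) (fun t => mul_pos (hj _) (hk _))
    (fun s t => by rw [hfj, hst]; ring) (ninf := f₁ bdInfty) (winf := j bdInfty * kinf)
    (mul_pos (hj _) hkinf) (fun t => by rw [hfj, hinf]; ring)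
  have hdist : ∀ s t : ℝ, s ≠ t → f₁ (bdReal s) ≠ f₁ (bdReal t) := fun s t hst =>
    h₁.ne fun e => hst (bdReal_injective e)
  obtain ⟨g, g1, g2, g0⟩ := htrans (f₁ (bdReal (t₀ + 1))) (f₁ (bdReal (t₀ + 2))) (f₁ (bdReal t₀))
    (f₁ m) (f₂ m) (f₁ N) (hdist _ _ (by norm_num)) (hdist _ _ (by norm_num))
    (hdist _ _ (by norm_num)) hne (h₁.ne hmN) (aN ▸ h₂.ne hmN)
  obtain ⟨J, hJ, hgJ⟩ := hX.vis_map_conformal g x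
  obtain ⟨P', hP'⟩ : ∃ P', Boundary.map g P' = f₁ P := ⟨_, Boundary.map_map_symm g _⟩
  obtain ⟨Q', hQ'⟩ : ∃ Q', Boundary.map g Q' = f₁ Q := ⟨_, Boundary.map_map_symm g _⟩
  have hpull : ∀ t, vis x (Boundary.map g P') (Boundary.map g (f₁ (bdReal t))) *
        vis x (Boundary.map g Q') (Boundary.map g (f₁ (bdReal t₀))) =
        θ * (vis x (Boundary.map g P') (Boundary.map g Q') *
          vis x (Boundary.map g (f₁ (bdReal t))) (Boundary.map g (f₁ (bdReal t₀)))) ∧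
      vis x (Boundary.map g Q') (Boundary.map g (f₁ (bdReal t))) *
        vis x (Boundary.map g P') (Boundary.map g (f₁ (bdReal t₀))) =
        (1 - θ) * (vis x (Boundary.map g P') (Boundary.map g Q') *
          vis x (Boundary.map g (f₁ (bdReal t))) (Boundary.map g (f₁ (bdReal t₀)))) →
      vis x P' (f₁ (bdReal t)) * vis x Q' (f₁ (bdReal t₀)) =
        θ * (vis x P' Q' * vis x (f₁ (bdReal t)) (f₁ (bdReal t₀))) ∧
      vis x Q' (f₁ (bdReal t)) * vis x P' (f₁ (bdReal t₀)) =
        (1 - θ) * (vis x P' Q' * vis x (f₁ (bdReal t)) (f₁ (bdReal t₀))) := by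
    rintro t ⟨a1, a2⟩
    simp only [hgJ] at a1 a2
    have hJJ : J P' * J Q' * J (f₁ (bdReal t)) * J (f₁ (bdReal t₀)) ≠ 0 :=
      (mul_pos (mul_pos (mul_pos (hJ _) (hJ _)) (hJ _)) (hJ _)).ne'
    exact ⟨mul_left_cancel₀ hJJ (by linear_combination a1),
      mul_left_cancel₀ hJJ (by linear_combination a2)⟩
  have hcontra := hreg P' Q' (t₀ + 1) (t₀ + 2) θ (by norm_num) (by norm_num)
    (fun e => h₁.ne hPN (by rw [← hP', e, g0])) (fun e => h₁.ne hQN (by rw [← hQ', e, g0]))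
    (fun e => h₁.ne hPQ (by rw [← hP', e, hQ'])) (by
      rintro t (rfl | rfl)
      · exact hpull _ (by rw [hP', hQ', g0, g1]; exact r1)
      · exact hpull _ (by rw [hP', hQ', g0, g2]; exact r2))
  linarith

/-- For a Moebius embedding `f`, every point `p` of the hyperbolic plane has a counterpart in `X`,
from which the image of `f` looks the same as the boundary circle looks from `p`. It is found on the
image of a geodesic line through `p`. -/
theorem IsMoebius.exists_center [ProperSpace X] [Nonempty X] (hX : HasStewart X) {o : ℍ} {x : X}
    {f : Boundary ℍ → Boundary X} (hf : IsMoebius o x f) (p : ℍ) :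
    ∃ P : X, ∀ ξ η, vis P (f ξ) (f η) = vis p ξ η := by
  have hH := hasStewart_upperHalfPlane
  obtain ⟨m, rfl, -, hm, -⟩ := CATBoundary.exists_line p p
  have hends : m.posEnd ≠ m.negEnd := fun e => by
    have := hH.vis_line m 0
    rw [e, vis_self] at this
    exact zero_ne_one this
  obtain ⟨l, hln, hlp⟩ := hX.exists_line (hf.ne hends.symm)
  obtain ⟨j, hj, hfj⟩ := hf.basepoint (m.1 0) (l.1 0)
  set t := -2 * Real.log (j m.posEnd) with ht
  set l' := geodesicFlow t l with hl'
  have hl'0 : l'.1 0 = l.1 t := congrArg l.1 (zero_add t)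
  set J : Boundary ℍ → ℝ := fun ξ => conf (l.1 0) (l.1 t) (f ξ) * j ξ with hJdef
  have hJ0 : ∀ ξ, 0 < J ξ := fun ξ => mul_pos (conf_pos _ _ _) (hj ξ)
  have hJ : ∀ ξ η, vis (l.1 t) (f ξ) (f η) = J ξ * J η * vis (m.1 0) ξ η := fun ξ η => by
    rw [vis_conf (l.1 0), hfj]; ring
  have hJpos : J m.posEnd = 1 := by
    simp only [hJdef]
    rw [← hlp, hX.conf_line, ht, show (-2 * Real.log (j m.posEnd) - 0) / 2 =
      -Real.log (j m.posEnd) by ring, Real.exp_neg, Real.exp_log (hj _),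
      inv_mul_cancel₀ (hj _).ne']
  have hJneg : J m.negEnd = 1 := by
    have h1 := hJ m.posEnd m.negEnd
    rwa [hH.vis_line, ← hlp, ← hln, hX.vis_line, hJpos, one_mul, mul_one, eq_comm] at h1
  have hge : ∀ η, 1 ≤ J η := fun η => by
    have h1 := hX.one_le_vis_sq l' (f η)
    rw [hl', posEnd_flow, negEnd_flow, ← hl', hl'0, hlp, hln, hJ, hJ, hJpos, hJneg] at h1
    have h2 := hm.vis_sq hH η
    have h3 : 1 ≤ J η ^ 2 := by
      calc 1 ≤ _ := h1
        _ = J η ^ 2 * (vis (m.1 0) m.posEnd η ^ 2 + vis (m.1 0) m.negEnd η ^ 2) := by ring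
        _ = J η ^ 2 := by rw [h2, mul_one]
    exact (one_le_sq_iff₀ (hJ0 η).le).1 h3
  have hone : ∀ η, J η = 1 := fun η => by
    obtain ⟨η', hη'⟩ := exists_antipode (m.1 0) η
    have h1 := hJ η η'
    rw [hη', mul_one] at h1
    have h2 := vis_le_one (l.1 t) (f η) (f η')
    rw [h1] at h2
    nlinarith [hge η, hge η']
  exact ⟨l.1 t, fun ξ η => by rw [hJ, hone, hone, one_mul, one_mul]⟩

/-- The map of `IsMoebius.exists_center` takes geodesic lines to geodesic lines. -/
theorem exists_line_of_center [ProperSpace X] [Nonempty X] (hX : HasStewart X)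
    {f : Boundary ℍ → Boundary X} {F : ℍ → X} (hF : ∀ p ξ η, vis (F p) (f ξ) (f η) = vis p ξ η)
    (m : GeodesicLine ℍ) : ∃ l : GeodesicLine X, (∀ t, F (m.1 t) = l.1 t) ∧
      l.posEnd = f m.posEnd ∧ l.negEnd = f m.negEnd := by
  have hH := hasStewart_upperHalfPlane
  have hinj : ∀ {ξ η}, ξ ≠ η → f ξ ≠ f η := fun {ξ η} h e => by
    have h1 := hF (m.1 0) ξ η
    rw [e, vis_self] at h1
    exact (hH.vis_pos _ h).ne h1
  set ξ := m.posEnd with hξ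
  set ξ' := m.negEnd with hξ'
  have hends : ξ ≠ ξ' := fun e => by
    have := hH.vis_line m 0
    rw [← hξ, ← hξ', e, vis_self] at this
    exact zero_ne_one this
  obtain ⟨ζ, hζ, hζ'⟩ : ∃ ζ, ζ ≠ ξ ∧ ζ ≠ ξ' := by
    have h01 : bdReal 0 ≠ bdReal 1 := fun e => zero_ne_one (bdReal_injective e)
    have h0 := bdInfty_ne_bdReal 0
    have h1 := bdInfty_ne_bdReal 1
    by_contra! h
    have a := h bdInfty
    have b := h (bdReal 0)
    have c := h (bdReal 1)
    rcases eq_or_ne bdInfty ξ with e | e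
    · exact h01 ((b fun e' => h0 (e.trans e'.symm)).trans (c fun e' => h1 (e.trans e'.symm)).symm)
    · rcases eq_or_ne (bdReal 0) ξ with e0 | e0
      · exact h1 ((a e).trans (c fun e' => h01 (e0.trans e'.symm)).symm)
      · exact h0 ((a e).trans (b e0).symm)
  -- comparison of the Busemann functions of corresponding boundary points
  have hconf : ∀ s t, conf (F (m.1 s)) (F (m.1 t)) (f ξ) = Real.exp ((t - s) / 2) := by
    intro s t
    have hpair : ∀ a b, a ≠ b → conf (F (m.1 s)) (F (m.1 t)) (f a) *
        conf (F (m.1 s)) (F (m.1 t)) (f b) = conf (m.1 s) (m.1 t) a * conf (m.1 s) (m.1 t) b := by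
      intro a b hab
      have h1 := vis_conf (F (m.1 s)) (F (m.1 t)) (f a) (f b)
      rw [hF, hF, vis_conf (m.1 s) (m.1 t) a b] at h1
      exact (mul_right_cancel₀ (hH.vis_pos _ hab).ne' h1).symm
    have h1 := hpair ξ ξ' hends
    have h2 := hpair ξ ζ hζ.symm
    have h3 := hpair ξ' ζ hζ'.symm
    rw [← hH.conf_line m s t, ← hξ]
    have p1 := conf_pos (F (m.1 s)) (F (m.1 t)) (f ξ)
    have p2 := conf_pos (F (m.1 s)) (F (m.1 t)) (f ξ')
    have p3 := conf_pos (F (m.1 s)) (F (m.1 t)) (f ζ)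
    have q1 := conf_pos (m.1 s) (m.1 t) ξ
    have q2 := conf_pos (m.1 s) (m.1 t) ξ'
    have q3 := conf_pos (m.1 s) (m.1 t) ζ
    refine (pow_left_inj₀ p1.le q1.le two_ne_zero).1 (mul_right_cancel₀ (mul_pos p2 p3).ne' ?_)
    calc _ = (conf (F (m.1 s)) (F (m.1 t)) (f ξ) * conf (F (m.1 s)) (F (m.1 t)) (f ξ')) *
          (conf (F (m.1 s)) (F (m.1 t)) (f ξ) * conf (F (m.1 s)) (F (m.1 t)) (f ζ)) := by ring
      _ = conf (m.1 s) (m.1 t) ξ ^ 2 * (conf (m.1 s) (m.1 t) ξ' * conf (m.1 s) (m.1 t) ζ) := by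
        rw [h1, h2]; ring
      _ = _ := by rw [h3]
  obtain ⟨l, hln, hlp⟩ := hX.exists_line (hinj hends.symm)
  set C := conf (F (m.1 0)) (l.1 0) (f ξ) with hC
  have hC0 : 0 < C := conf_pos _ _ _
  set a := -2 * Real.log C with ha
  refine ⟨geodesicFlow a l, fun t => ?_, by rw [posEnd_flow, hlp], by rw [negEnd_flow, hln]⟩
  change F (m.1 t) = l.1 (t + a)
  refine hX.eq_of_conf_eq_one (ξ := f ξ) (η := f ξ') ?_ ?_ ?_
  · rw [hF, hξ, hξ', hH.vis_line]
  · rw [← hlp, ← hln, hX.vis_line]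
  · rw [← conf_mul _ (F (m.1 0)), hconf, ← conf_mul _ (l.1 0), ← hC, ← hlp, hX.conf_line]
    nth_rewrite 1 [← Real.exp_log hC0]
    rw [← Real.exp_add, ← Real.exp_add, Real.exp_eq_one_iff, ha]
    ring

theorem IsMoebius.conjugatesGeodesicFlows [ProperSpace X] [Nonempty X] (hX : HasStewart X) {o : ℍ}
    {x : X} {f : Boundary ℍ → Boundary X} (hf : IsMoebius o x f) : ConjugatesGeodesicFlows f := by
  choose F hF using hf.exists_center hX
  have hline := exists_line_of_center hX hF
  have hiso : Isometry F := Isometry.of_dist_eq fun p q => by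
    obtain ⟨m, h0, h1, -⟩ := CATBoundary.exists_line p q
    obtain ⟨l, hl, -⟩ := hline m
    have e := l.dist_eq 0 (dist p q)
    rwa [← hl, ← hl, h0, h1, zero_sub, abs_neg, abs_of_nonneg dist_nonneg] at e
  refine ⟨fun c => ⟨⟨fun t => F (c.1 t), hiso.continuous.comp c.1.continuous⟩, hiso.comp c.2⟩,
    ?_, fun t c => rfl, fun c => ?_⟩
  · rw [← isUniformEmbedding_subtype_val.of_comp_iff]
    exact (ContinuousMap.isUniformEmbedding_comp ⟨F, hiso.continuous⟩ hiso.isUniformEmbedding).comp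
      isUniformEmbedding_subtype_val
  · obtain ⟨l, hl, hp, hn⟩ := hline c
    rw [← hp, ← hn]
    constructor
    · exact endpoint_eq_iff.2 ⟨0, fun t => (dist_eq_zero.2 (hl t)).le⟩
    · exact endpoint_eq_iff.2 ⟨0, fun t => (dist_eq_zero.2 (hl _)).le⟩

end Embedding

/-! ### Limits of asymptotically Moebius sequences -/

/-- A map which preserves the cross ratios of quadruples of distinct points, in the form without
denominators, is injective as soon as it is injective on some triple. -/
theorem injective_of_crossRatio {A B : Type*} {v : A → A → ℝ} {V : B → B → ℝ}
    (hv : ∀ ξ η, ξ ≠ η → 0 < v ξ η) (hV : ∀ ξ η, ξ ≠ η → 0 < V ξ η) (hV0 : ∀ ξ, V ξ ξ = 0)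
    {f : A → B} {a b c : A} (hab : f a ≠ f b) (hac : f a ≠ f c) (hbc : f b ≠ f c)
    (h : ∀ ξ₀ η₀ ξ₁ η₁, Distinct4 ξ₀ η₀ ξ₁ η₁ →
      V (f ξ₀) (f ξ₁) * V (f η₀) (f η₁) * (v ξ₀ η₁ * v ξ₁ η₀) =
        v ξ₀ ξ₁ * v η₀ η₁ * (V (f ξ₀) (f η₁) * V (f ξ₁) (f η₀))) : Function.Injective f := by
  have key : ∀ {ξ₀ η₀ ξ₁ η₁}, Distinct4 ξ₀ η₀ ξ₁ η₁ → f ξ₀ ≠ f η₁ → f ξ₁ ≠ f η₀ →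
      f ξ₀ ≠ f ξ₁ := by
    intro ξ₀ η₀ ξ₁ η₁ hd h1 h2 e
    have h3 := h ξ₀ η₀ ξ₁ η₁ hd
    rw [← e, hV0, zero_mul, zero_mul, e] at h3
    obtain ⟨-, h02, -, -, h13, -⟩ := hd
    exact (mul_pos (mul_pos (hv _ _ h02) (hv _ _ h13))
      (mul_pos (hV _ _ (e ▸ h1)) (hV _ _ h2))).ne h3
  have off : ∀ {p q r : A}, f p ≠ f q → f p ≠ f r → f q ≠ f r → ∀ ζ, ζ ≠ p → ζ ≠ q → ζ ≠ r →
      f p ≠ f ζ := by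
    intro p q r hpq hpr hqr ζ h1 h2 h3 e
    exact key ⟨ne_of_apply_ne f hpq, h1.symm, ne_of_apply_ne f hpr, h2.symm,
      ne_of_apply_ne f hqr, h3⟩ hpr (e ▸ hpq) e
  have offa := fun ζ (h1 : ζ ≠ a) (h2 : ζ ≠ b) (h3 : ζ ≠ c) => off hab hac hbc ζ h1 h2 h3
  have offb := fun ζ (h1 : ζ ≠ a) (h2 : ζ ≠ b) (h3 : ζ ≠ c) => off hab.symm hbc hac ζ h2 h1 h3
  have offc := fun ζ (h1 : ζ ≠ a) (h2 : ζ ≠ b) (h3 : ζ ≠ c) =>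
    off hac.symm hbc.symm hab ζ h3 h1 h2
  have main : ∀ ξ η, ξ ≠ a → ξ ≠ b → ξ ≠ c → f ξ = f η → ξ = η := by
    intro ξ η h1 h2 h3 e
    by_contra hne
    have k1 : η ≠ a := fun e' => offa ξ h1 h2 h3 (e' ▸ e.symm)
    have k2 : η ≠ b := fun e' => offb ξ h1 h2 h3 (e' ▸ e.symm)
    have k3 : η ≠ c := fun e' => offc ξ h1 h2 h3 (e' ▸ e.symm)
    exact key ⟨h1, hne, h2, k1.symm, ne_of_apply_ne f hab, k2⟩ (offb ξ h1 h2 h3).symm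
      (offa η k1 k2 k3).symm e
  intro ξ η e
  by_cases hξ : ξ ≠ a ∧ ξ ≠ b ∧ ξ ≠ c
  · exact main ξ η hξ.1 hξ.2.1 hξ.2.2 e
  by_cases hη : η ≠ a ∧ η ≠ b ∧ η ≠ c
  · exact (main η ξ hη.1 hη.2.1 hη.2.2 e.symm).symm
  have hξ' : ξ = a ∨ ξ = b ∨ ξ = c := by tauto
  have hη' : η = a ∨ η = b ∨ η = c := by tauto
  rcases hξ' with rfl | rfl | rfl <;> rcases hη' with rfl | rfl | rfl <;>
    first
      | rfl
      | exact absurd e hab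
      | exact absurd e hac
      | exact absurd e hbc
      | exact absurd e.symm hab
      | exact absurd e.symm hac
      | exact absurd e.symm hbc

theorem Boundary.map_injective {X : Type*} [MetricSpace X] (g : X ≃ᵢ X) :
    Function.Injective (Boundary.map g) := fun ξ η e => by
  have := congrArg (Boundary.map g.symm) e
  have h := Boundary.map_map_symm g.symm
  rw [g.symm_symm] at h
  rwa [h, h] at this

theorem HasStewart.crossRatio_map {X : Type*} [MetricSpace X] [ProperSpace X] (hX : HasStewart X)
    (p : X) (g : X ≃ᵢ X) {ξ₀ η₀ ξ₁ η₁ : Boundary X} (h1 : ξ₀ ≠ η₁) (h2 : ξ₁ ≠ η₀) :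
    crossRatio (Boundary.map g ξ₀) (Boundary.map g η₀) (Boundary.map g ξ₁) (Boundary.map g η₁) =
      crossRatio ξ₀ η₀ ξ₁ η₁ := by
  have hg := Boundary.map_injective g
  rw [hX.crossRatio_eq p (hX.vis_pos p h1).ne' (hX.vis_pos p h2).ne',
    hX.crossRatio_eq p (hX.vis_pos p (hg.ne h1)).ne' (hX.vis_pos p (hg.ne h2)).ne']
  obtain ⟨j, hj, hjv⟩ := vis_map_conformal hX g p
  simp only [hjv]
  have := (hX.vis_pos p h1).ne'
  have := (hX.vis_pos p h2).ne'
  have := (hj ξ₀).ne'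
  have := (hj η₀).ne'
  have := (hj ξ₁).ne'
  have := (hj η₁).ne'
  field_simp

/-- A limit of an asymptotically Moebius sequence which is injective on some triple is a Moebius
embedding. -/
theorem isMoebius_of_rayTendsto {X : Type*} [MetricSpace X] [ProperSpace X] (hX : HasStewart X)
    {o : ℍ} {x : X} {ψ : ℕ → Boundary ℍ → Boundary X} (hψ : AsymptoticallyMoebius ψ)
    {l : Filter ℕ} [l.NeBot] (hl : l ≤ atTop) {f : Boundary ℍ → Boundary X}
    (hf : ∀ ξ, hX.RayTendsto x (fun k => ψ k ξ) l (f ξ)) {a b c : Boundary ℍ}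
    (hab : f a ≠ f b) (hac : f a ≠ f c) (hbc : f b ≠ f c) : IsMoebius o x f := by
  have hH := hasStewart_upperHalfPlane
  have hv : ∀ ξ η : Boundary ℍ, ξ ≠ η → 0 < vis o ξ η := fun _ _ h => hH.vis_pos o h
  have hV : ∀ ξ η : Boundary X, ξ ≠ η → 0 < vis x ξ η := fun _ _ h => hX.vis_pos x h
  have h : ∀ ξ₀ η₀ ξ₁ η₁, Distinct4 ξ₀ η₀ ξ₁ η₁ →
      vis x (f ξ₀) (f ξ₁) * vis x (f η₀) (f η₁) * (vis o ξ₀ η₁ * vis o ξ₁ η₀) =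
        vis o ξ₀ ξ₁ * vis o η₀ η₁ * (vis x (f ξ₀) (f η₁) * vis x (f ξ₁) (f η₀)) := by
    intro ξ₀ η₀ ξ₁ η₁ hd
    obtain ⟨hev, hlim⟩ := hψ ξ₀ η₀ ξ₁ η₁ hd
    have p1 := hv _ _ hd.2.2.1
    have p2 := hv _ _ hd.2.2.2.1.symm
    have hlhs := ((hf ξ₀).vis (hf ξ₁)).mul ((hf η₀).vis (hf η₁))
    have hrhs := (hlim.mono_left hl).mul (((hf ξ₀).vis (hf η₁)).mul ((hf ξ₁).vis (hf η₀)))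
    have hEq : ∀ᶠ k in l, vis x (ψ k ξ₀) (ψ k ξ₁) * vis x (ψ k η₀) (ψ k η₁) =
        crossRatio (ψ k ξ₀) (ψ k η₀) (ψ k ξ₁) (ψ k η₁) *
          (vis x (ψ k ξ₀) (ψ k η₁) * vis x (ψ k ξ₁) (ψ k η₀)) := by
      filter_upwards [hl hev] with k hk
      have q1 := (hV _ _ hk.2.2.1).ne'
      have q2 := (hV _ _ hk.2.2.2.1.symm).ne'
      rw [hX.crossRatio_eq x q1 q2, div_mul_cancel₀ _ (mul_ne_zero q1 q2)]
    have := tendsto_nhds_unique (hlhs.congr' hEq) hrhs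
    rw [this, hH.crossRatio_eq o p1.ne' p2.ne']
    field_simp
  exact exists_conformal_factor hv (vis_self o) (vis_comm o) hV (vis_self x) (vis_comm x)
    (injective_of_crossRatio hv hV (vis_self x) hab hac hbc h)
    (ne_of_apply_ne f hab) (ne_of_apply_ne f hac) (ne_of_apply_ne f hbc) h

theorem HasStewart.rayTendsto_of_eventually_eq {X : Type*} [MetricSpace X] [ProperSpace X]
    (hX : HasStewart X) {ι : Type*} (p : X) {u : ι → Boundary X} {l : Filter ι} {ξ : Boundary X}
    (h : ∀ᶠ k in l, u k = ξ) : hX.RayTendsto p u l ξ := fun t =>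
  tendsto_const_nhds.congr' (h.mono fun k hk => by simp only [hk])

end CATBoundary

theorem mainTheorem2 {X : Type*} [MetricSpace X] [ProperSpace X]
    (hX : CATBoundary.IsCATNegOne X) (htrans : CATBoundary.TransitiveOnTriples X)
    (o : ℍ) (x : X)
    (φ : ℕ → CATBoundary.Boundary ℍ → CATBoundary.Boundary X)
    (hcont : ∀ k, @Continuous _ _ (CATBoundary.coneTopology o) (CATBoundary.coneTopology x) (φ k))
    (hφ : CATBoundary.AsymptoticallyMoebius φ) :
    ∃ (g : ℕ → (X ≃ᵢ X)) (φlim : CATBoundary.Boundary ℍ → CATBoundary.Boundary X),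
      (∀ ξ : CATBoundary.Boundary ℍ,
        Tendsto (fun k => CATBoundary.Boundary.map (g k) (φ k ξ)) atTop
          (@nhds _ (CATBoundary.coneTopology x) (φlim ξ))) ∧
      CATBoundary.ConjugatesGeodesicFlows φlim := by
  open CATBoundary in
  have hS := hX.hasStewart
  have : Nonempty X := ⟨x⟩
  have hdist : Distinct4 bdInfty (bdReal 0) (bdReal 1) (bdReal 2) := by
    refine ⟨bdInfty_ne_bdReal _, bdInfty_ne_bdReal _, bdInfty_ne_bdReal _, ?_, ?_, ?_⟩ <;>
      exact bdReal_injective.ne (by norm_num)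
  have hev : ∀ᶠ k in atTop, φ k bdInfty ≠ φ k (bdReal 0) ∧ φ k bdInfty ≠ φ k (bdReal 1) ∧
      φ k (bdReal 0) ≠ φ k (bdReal 1) :=
    (hφ _ _ _ _ hdist).1.mono fun k hk => ⟨hk.1, hk.2.1, hk.2.2.2.1⟩
  -- the isometries `g k` move the images of the triple `∞, 0, 1` to a fixed triple
  obtain ⟨k₀, hab, hac, hbc⟩ := hev.exists
  have hg : ∀ k, ∃ g : X ≃ᵢ X, (φ k bdInfty ≠ φ k (bdReal 0) ∧ φ k bdInfty ≠ φ k (bdReal 1) ∧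
      φ k (bdReal 0) ≠ φ k (bdReal 1)) → Boundary.map g (φ k bdInfty) = φ k₀ bdInfty ∧
      Boundary.map g (φ k (bdReal 0)) = φ k₀ (bdReal 0) ∧
      Boundary.map g (φ k (bdReal 1)) = φ k₀ (bdReal 1) := by
    intro k
    by_cases h : φ k bdInfty ≠ φ k (bdReal 0) ∧ φ k bdInfty ≠ φ k (bdReal 1) ∧
      φ k (bdReal 0) ≠ φ k (bdReal 1)
    · obtain ⟨g, hg⟩ := htrans _ _ _ _ _ _ h.1 h.2.1 h.2.2 hab hac hbc
      exact ⟨g, fun _ => hg⟩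
    · exact ⟨IsometryEquiv.refl X, fun h' => absurd h' h⟩
  choose g hg using hg
  set ψ : ℕ → Boundary ℍ → Boundary X := fun k ξ => Boundary.map (g k) (φ k ξ) with hψ
  have hψM : AsymptoticallyMoebius ψ := fun ξ₀ η₀ ξ₁ η₁ hd => by
    obtain ⟨h1, h2⟩ := hφ _ _ _ _ hd
    have hi := fun k => Boundary.map_injective (g k)
    refine ⟨h1.mono fun k hk => ⟨(hi k).ne hk.1, (hi k).ne hk.2.1, (hi k).ne hk.2.2.1,
      (hi k).ne hk.2.2.2.1, (hi k).ne hk.2.2.2.2.1, (hi k).ne hk.2.2.2.2.2⟩,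
      h2.congr' (h1.mono fun k hk => ?_)⟩
    exact (hS.crossRatio_map x (g k) hk.2.2.1 hk.2.2.2.1.symm).symm
  -- every ultrafilter limit is a Moebius embedding with the same values on the triple
  have hlim : ∀ U : Ultrafilter ℕ, (U : Filter ℕ) ≤ atTop → ∃ f : Boundary ℍ → Boundary X,
      (∀ ξ, hS.RayTendsto x (fun k => ψ k ξ) U (f ξ)) ∧ IsMoebius o x f ∧
      f bdInfty = φ k₀ bdInfty ∧ f (bdReal 0) = φ k₀ (bdReal 0) ∧
      f (bdReal 1) = φ k₀ (bdReal 1) := by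
    intro U hU
    choose f hf using fun ξ => hS.exists_rayTendsto x U (fun k => ψ k ξ)
    have ea : f bdInfty = φ k₀ bdInfty := (hf _).unique
      (hS.rayTendsto_of_eventually_eq x ((hev.filter_mono hU).mono fun k hk => (hg k hk).1))
    have eb : f (bdReal 0) = φ k₀ (bdReal 0) := (hf _).unique
      (hS.rayTendsto_of_eventually_eq x ((hev.filter_mono hU).mono fun k hk => (hg k hk).2.1))
    have ec : f (bdReal 1) = φ k₀ (bdReal 1) := (hf _).unique
      (hS.rayTendsto_of_eventually_eq x ((hev.filter_mono hU).mono fun k hk => (hg k hk).2.2))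
    refine ⟨f, hf, isMoebius_of_rayTendsto hS hψM hU hf (a := bdInfty) (b := bdReal 0)
      (c := bdReal 1) ?_ ?_ ?_, ea, eb, ec⟩
    · rwa [ea, eb]
    · rwa [ea, ec]
    · rwa [eb, ec]
  obtain ⟨f, -, hfM, ea, eb, ec⟩ := hlim (hyperfilter ℕ) Nat.hyperfilter_le_atTop
  refine ⟨g, f, fun ξ => ?_, hfM.conjugatesGeodesicFlows hS⟩
  refine HasStewart.RayTendsto.tendsto (hX := hS) fun t => tendsto_iff_ultrafilter _ _ _ |>.2 ?_
  intro U hU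
  obtain ⟨f', hf', hfM', ea', eb', ec'⟩ := hlim U hU
  rw [IsMoebius.eq hS htrans hfM hfM' (ea.trans ea'.symm) (eb.trans eb'.symm) (ec.trans ec'.symm)]
  exact hf' ξ t
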